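/- Let $k$ be an infinite field and $A$ a finite-dimensional (associative, unital) $k$-algebra. Let $A\text{-mod}$ be the category of finite-dimensional left $A$-modules, $A\text{-proj}$ its full subcategory of projective modules, $K^b(A\text{-proj})$ the homotopy category of bounded cochain complexes over $A\text{-proj}$, and $D^b(A\text{-mod})$ the bounded derived category of $A\text{-mod}$. For an integer $m\ge 0$ let $C_m(A\text{-proj})$ be the category (with chain maps as morphisms) of the complexes $X=(X^i,d^i)$ over $A\text{-proj}$ with $X^i=0$ for $i\notin\{0,\dots,m\}$ and $\operatorname{Im} d^i\subseteq \operatorname{rad} X^{i+1}$ for all $i$. The cohomological range of a complex $X$ whose cohomology is finite-dimensional, concentrated in finitely many degrees and not identically zero is $$\mathrm{hr}(X)=\max_{i\in\mathbb Z}\dim_k H^i(X)\;\cdot\;\max\{\,j-i+1 : H^i(X)\neq 0\neq H^j(X)\,\},$$ and $\mathrm{hr}(X)=0$ if all $H^i(X)$ vanish. We say that $C_m(A\text{-proj})$ is of strongly unbounded type if there is a strictly increasing sequence $(r_i)_{i\in\mathbb N}$ of natural numbers such that for each $i$ there are, up to isomorphism, infinitely many indecomposable objects of $C_m(A\text{-proj})$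 with cohomological range $r_i$. We say that $K^b(A\text{-proj})$ is of strongly unbounded type (respectively, that $A$ is strongly derived unbounded) if there is a strictly increasing sequence $(r_i)_{i\in\mathbb N}$ of natural numbers such that for each $i$ there are, up to shift and isomorphism, infinitely many indecomposable objects of $K^b(A\text{-proj})$ (respectively, of $D^b(A\text{-mod})$) with cohomological range $r_i$. Then: 1. If $C_m(A\text{-proj})$ is of strongly unbounded type for some $m\ge 1$, then $K^b(A\text{-proj})$ is of strongly unbounded type. 2. $K^b(A\text{-proj})$ is of strongly unbounded type if and only if $A$ is strongly derived unbounded. -/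

import Mathlib

open CategoryTheory CategoryTheory.Limits
open scoped ZeroObject

universe w u v

namespace DerivedRepType

noncomputable section

section Modules

attribute [local instance] ModuleCat.moduleOfAlgebraModule
  ModuleCat.isScalarTower_of_algebra_moduleCat

variable (k : Type u) [Field k] (A : Type v) [Ring A] [Algebra k A]

/-- The left `A`-modules that are finite-dimensional over `k` (where `k` acts through `A`). -/
def isFinDim : ObjectProperty (ModuleCat.{v} A) :=
  fun M => Module.Finite k M

/-- The category `A-mod` of finite-dimensional left `A`-modules. -/
abbrev FinDimMod : Type (v + 1) := (isFinDim k A).FullSubcategory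

variable {k A} in
/-- The dimension over `k` of an object of `A-mod`. -/
def dim (M : FinDimMod k A) : ℕ := Module.finrank k M.obj

instance (M : FinDimMod k A) : Module.Finite k M.obj := M.property

lemma isFinDim_of_injective {M N : ModuleCat.{v} A} (f : M →ₗ[A] N)
    (hf : Function.Injective f) (hN : isFinDim k A N) : isFinDim k A M := by
  have : Module.Finite k N := hN
  exact Module.Finite.of_injective (f.restrictScalars k) hf

lemma isFinDim_of_surjective {M N : ModuleCat.{v} A} (f : M →ₗ[A] N)
    (hf : Function.Surjective f) (hM : isFinDim k A M) : isFinDim k A N := by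
  have : Module.Finite k M := hM
  exact Module.Finite.of_surjective (f.restrictScalars k) hf

instance : (isFinDim k A).IsClosedUnderIsomorphisms where
  of_iso e h := isFinDim_of_injective k A e.inv.hom
    ((ModuleCat.mono_iff_injective e.inv).1 inferInstance) h

instance : (isFinDim k A).ContainsZero where
  exists_zero := ⟨ModuleCat.of A PUnit, ModuleCat.isZero_of_subsingleton _,
    show Module.Finite k (ModuleCat.of A PUnit.{v + 1}) from
      haveI : Finite (ModuleCat.of A PUnit.{v + 1}) := inferInstanceAs (Finite PUnit)
      inferInstance⟩

instance : (isFinDim k A).IsClosedUnderSubobjects where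
  prop_of_mono f _ h := isFinDim_of_injective k A f.hom
    ((ModuleCat.mono_iff_injective f).1 inferInstance) h

instance : (isFinDim k A).IsClosedUnderQuotients where
  prop_of_epi f _ h := isFinDim_of_surjective k A f.hom
    ((ModuleCat.epi_iff_surjective f).1 inferInstance) h

instance : (isFinDim k A).IsClosedUnderFiniteProducts where
  isClosedUnderLimitsOfShape J _ :=
    { limitsOfShape_le := by
        rintro X ⟨p⟩
        have hfin : ∀ j, Module.Finite k (p.diag.obj j) := p.prop_diag_obj
        let f : X →ₗ[A] (∀ j : Discrete J, p.diag.obj j) :=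
          LinearMap.pi fun j => (p.π.app j).hom
        have hf : Function.Injective f := by
          rw [← LinearMap.ker_eq_bot, LinearMap.ker_eq_bot']
          intro x hx
          have h0 : ModuleCat.ofHom (LinearMap.toSpanSingleton A X x) = 0 := by
            refine p.isLimit.hom_ext fun j => ?_
            ext
            simpa [f] using congrFun hx j
          simpa using congrArg (fun g => g.hom 1) h0
        exact Module.Finite.of_injective (f.restrictScalars k) hf }

/-- `A-proj`: the finite-dimensional left `A`-modules that are projective. -/
def isProj : ObjectProperty (FinDimMod k A) :=
  fun M => Module.Projective A M.obj

lemma isProj_biprod {M N : FinDimMod k A} (hM : isProj k A M) (hN : isProj k A N) :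
    isProj k A (M ⊞ N) := by
  have : Module.Projective A M.obj := hM
  have : Module.Projective A N.obj := hN
  refine Module.Projective.of_split (M := M.obj × N.obj) (P := (M ⊞ N).obj)
    (LinearMap.prod (biprod.fst : M ⊞ N ⟶ M).hom.hom (biprod.snd : M ⊞ N ⟶ N).hom.hom)
    (LinearMap.coprod (biprod.inl : M ⟶ M ⊞ N).hom.hom (biprod.inr : N ⟶ M ⊞ N).hom.hom) ?_
  have h := biprod.total (X := M) (Y := N)
  ext x
  exact congrArg (fun g : M ⊞ N ⟶ M ⊞ N => g.hom.hom x) h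

instance : (isProj k A).IsClosedUnderIsomorphisms where
  of_iso {M N} e hM := by
    have : Module.Projective A M.obj := hM
    exact Module.Projective.of_equiv (M := M.obj) ((isFinDim k A).ι.mapIso e).toLinearEquiv

lemma isProj_of_isZero {M : FinDimMod k A} (hM : IsZero M) : isProj k A M := by
  have h := (isFinDim k A).ι.map_isZero hM
  have : Subsingleton M.obj := ModuleCat.subsingleton_of_isZero h
  exact inferInstanceAs (Module.Projective A M.obj)

/-- The objects of `C^b(A-proj)`: bounded cochain complexes of finitely generated
projective left `A`-modules. -/
def isBoundedProj : ObjectProperty (CochainComplex (FinDimMod k A) ℤ) :=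
  fun X => (∃ a b : ℤ, ∀ i, i ∉ Set.Icc a b → IsZero (X.X i)) ∧ ∀ i, isProj k A (X.X i)

variable {k A} in
/-- A complex is homotopy minimal if the image of each differential `d^i` is contained in the
(Jacobson) radical of `X^{i+1}`. -/
def IsHomotopyMinimal (X : CochainComplex (FinDimMod k A) ℤ) : Prop :=
  ∀ i : ℤ, LinearMap.range (X.d i (i + 1)).hom.hom ≤ Module.jacobson A (X.X (i + 1)).obj

/-- The objects of `C_m(A-proj)`: homotopy minimal bounded complexes of finitely generated
projective left `A`-modules that vanish outside the degrees `0, …, m`. -/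
def isMinimalProj (m : ℕ) : ObjectProperty (CochainComplex (FinDimMod k A) ℤ) :=
  fun X => isBoundedProj k A X ∧ IsHomotopyMinimal X ∧
    ∀ i : ℤ, i ∉ Set.Icc (0 : ℤ) m → IsZero (X.X i)

end Modules

section Categories

variable (k : Type u) [Field k] (A : Type v) [Ring A] [Algebra k A]

variable {k A} in
lemma isZero_biprod {M N : FinDimMod k A} (hM : IsZero M) (hN : IsZero N) : IsZero (M ⊞ N) := by
  rw [IsZero.iff_id_eq_zero]
  exact biprod.hom_ext _ _ (hM.eq_of_tgt _ _) (hN.eq_of_tgt _ _)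

instance : (isBoundedProj k A).IsClosedUnderIsomorphisms where
  of_iso {X Y} e hX := by
    obtain ⟨⟨a, b, h⟩, hp⟩ := hX
    exact ⟨⟨a, b, fun i hi => (h i hi).of_iso ((HomologicalComplex.eval _ _ i).mapIso e.symm)⟩,
      fun i => (isProj k A).prop_of_iso ((HomologicalComplex.eval _ _ i).mapIso e) (hp i)⟩

lemma isBoundedProj_biprod {X Y : CochainComplex (FinDimMod k A) ℤ}
    (hX : isBoundedProj k A X) (hY : isBoundedProj k A Y) : isBoundedProj k A (X ⊞ Y) := by
  obtain ⟨⟨a, b, h⟩, hp⟩ := hX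
  obtain ⟨⟨a', b', h'⟩, hp'⟩ := hY
  refine ⟨⟨min a a', max b b', fun i hi => ?_⟩, fun i => ?_⟩
  · refine IsZero.of_iso (isZero_biprod (h i ?_) (h' i ?_))
      ((HomologicalComplex.eval _ _ i).mapBiprod X Y)
    all_goals simp only [Set.mem_Icc] at hi ⊢; omega
  · exact (isProj k A).prop_of_iso ((HomologicalComplex.eval _ _ i).mapBiprod X Y).symm
      (isProj_biprod k A (hp i) (hp' i))

variable {k A} in
lemma range_le_jacobson_of_comp {M N P Q : FinDimMod k A} (f : M ⟶ N) (g : N ⟶ P) (h : P ⟶ Q)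
    (hg : LinearMap.range g.hom.hom ≤ Module.jacobson A P.obj) (x : M.obj) :
    (f ≫ g ≫ h).hom.hom x ∈ Module.jacobson A Q.obj :=
  Module.map_jacobson_le h.hom.hom ⟨g.hom.hom (f.hom.hom x), hg ⟨_, rfl⟩, rfl⟩

variable {k A} in
lemma IsHomotopyMinimal.of_iso {X Y : CochainComplex (FinDimMod k A) ℤ} (e : X ≅ Y)
    (hX : IsHomotopyMinimal X) : IsHomotopyMinimal Y := by
  rintro i _ ⟨y, rfl⟩
  have h : Y.d i (i + 1) = e.inv.f i ≫ X.d i (i + 1) ≫ e.hom.f (i + 1) := by simp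
  rw [h]
  exact range_le_jacobson_of_comp _ _ _ (hX i) y

variable {k A} in
lemma IsHomotopyMinimal.biprod {X Y : CochainComplex (FinDimMod k A) ℤ}
    (hX : IsHomotopyMinimal X) (hY : IsHomotopyMinimal Y) : IsHomotopyMinimal (X ⊞ Y) := by
  rintro i _ ⟨y, rfl⟩
  have h : (X ⊞ Y).d i (i + 1) =
      (biprod.fst : X ⊞ Y ⟶ X).f i ≫ X.d i (i + 1) ≫ (biprod.inl : X ⟶ X ⊞ Y).f (i + 1) +
      (biprod.snd : X ⊞ Y ⟶ Y).f i ≫ Y.d i (i + 1) ≫ (biprod.inr : Y ⟶ X ⊞ Y).f (i + 1) := by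
    have ht : (biprod.fst : X ⊞ Y ⟶ X).f (i + 1) ≫ (biprod.inl : X ⟶ X ⊞ Y).f (i + 1) +
        (biprod.snd : X ⊞ Y ⟶ Y).f (i + 1) ≫ (biprod.inr : Y ⟶ X ⊞ Y).f (i + 1) =
        𝟙 ((X ⊞ Y).X (i + 1)) :=
      congrArg (fun φ : X ⊞ Y ⟶ X ⊞ Y => φ.f (i + 1)) (biprod.total (X := X) (Y := Y))
    rw [HomologicalComplex.Hom.comm_assoc, HomologicalComplex.Hom.comm_assoc,
      ← Preadditive.comp_add, ht, Category.comp_id]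
  rw [h]
  exact add_mem (range_le_jacobson_of_comp _ _ _ (hX i) y)
    (range_le_jacobson_of_comp _ _ _ (hY i) y)

/-- The category `C_m(A-proj)`. -/
abbrev MinimalComplexes (m : ℕ) : Type (v + 1) := (isMinimalProj k A m).FullSubcategory

/-- The objects of `K^b(A-proj)` inside the homotopy category of complexes over `A-mod`:
the bounded complexes of finitely generated projective modules. -/
def isKbProj : ObjectProperty (HomotopyCategory (FinDimMod k A) (.up ℤ)) :=
  (isBoundedProj k A).strictMap (HomotopyCategory.quotient _ _)

/-- The category `K^b(A-proj)`. -/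
abbrev HomotopyProj : Type (v + 1) := (isKbProj k A).FullSubcategory

instance (m : ℕ) : (isMinimalProj k A m).IsClosedUnderIsomorphisms where
  of_iso e hX := ⟨(isBoundedProj k A).prop_of_iso e hX.1, hX.2.1.of_iso e,
    fun i hi => (hX.2.2 i hi).of_iso ((HomologicalComplex.eval _ _ i).mapIso e.symm)⟩

instance (m : ℕ) : (isMinimalProj k A m).IsClosedUnderBinaryProducts where
  limitsOfShape_le := by
    rintro X ⟨p⟩
    have hl : isMinimalProj k A m (p.diag.obj ⟨.left⟩) := p.prop_diag_obj _
    have hr : isMinimalProj k A m (p.diag.obj ⟨.right⟩) := p.prop_diag_obj _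
    have e : X ≅ p.diag.obj ⟨.left⟩ ⊞ p.diag.obj ⟨.right⟩ :=
      IsLimit.conePointUniqueUpToIso
        ((IsLimit.postcomposeHomEquiv (diagramIsoPair p.diag) _).2 p.isLimit)
        (BinaryBiproduct.isLimit _ _)
    refine (isMinimalProj k A m).prop_of_iso e.symm
      ⟨isBoundedProj_biprod k A hl.1 hr.1, hl.2.1.biprod hr.2.1, fun i hi => ?_⟩
    exact IsZero.of_iso (isZero_biprod (hl.2.2 i hi) (hr.2.2 i hi))
      ((HomologicalComplex.eval _ _ i).mapBiprod _ _)

instance (m : ℕ) : HasBinaryBiproducts (MinimalComplexes k A m) :=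
  have : HasBinaryProducts (MinimalComplexes k A m) := inferInstance
  HasBinaryBiproducts.of_hasBinaryProducts

lemma isKbProj_quotient_obj_iff (X : CochainComplex (FinDimMod k A) ℤ) :
    isKbProj k A ((HomotopyCategory.quotient _ _).obj X) ↔ isBoundedProj k A X := by
  refine ⟨?_, fun h => ⟨_, h⟩⟩
  simp only [isKbProj, ObjectProperty.strictMap_iff]
  rintro ⟨Y, h, hY⟩
  obtain rfl : Y = X := congr_arg Quotient.as hY
  exact h

instance : (isKbProj k A).ContainsZero where
  exists_zero := by
    refine ⟨(HomotopyCategory.quotient _ _).obj 0, Functor.map_isZero _ (isZero_zero _), ?_⟩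
    rw [isKbProj_quotient_obj_iff]
    have h (i : ℤ) : IsZero ((0 : CochainComplex (FinDimMod k A) ℤ).X i) :=
      (HomologicalComplex.eval _ _ i).map_isZero (isZero_zero _)
    exact ⟨⟨0, 0, fun i _ => h i⟩, fun i => isProj_of_isZero k A (h i)⟩

instance : (isKbProj k A).IsStableUnderShift ℤ where
  isStableUnderShiftBy n :=
    { le_shift X hX := by
        obtain ⟨X : CochainComplex _ _, rfl⟩ := X.quotient_obj_surjective
        rw [isKbProj_quotient_obj_iff] at hX
        obtain ⟨⟨a, b, h⟩, hp⟩ := hX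
        rw [ObjectProperty.prop_shift_iff, HomotopyCategory.shift_quotient_obj,
          isKbProj_quotient_obj_iff]
        refine ⟨⟨a - n, b - n, fun i hi => h (i + n) ?_⟩, fun i => hp (i + n)⟩
        simp only [Set.mem_Icc] at hi ⊢
        omega }

lemma isBoundedProj_mappingCone {X Y : CochainComplex (FinDimMod k A) ℤ} (f : X ⟶ Y)
    (hX : isBoundedProj k A X) (hY : isBoundedProj k A Y) :
    isBoundedProj k A (CochainComplex.mappingCone f) := by
  obtain ⟨⟨a, b, h⟩, hp⟩ := hX
  obtain ⟨⟨a', b', h'⟩, hp'⟩ := hY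
  let e (i : ℤ) : (CochainComplex.mappingCone f).X i ≅ X.X (i + 1) ⊞ Y.X i :=
    HomologicalComplex.homotopyCofiber.XIsoBiprod f i (i + 1) rfl
  refine ⟨⟨min (a - 1) a', max (b - 1) b', fun i hi => ?_⟩, fun i => ?_⟩
  · refine IsZero.of_iso (isZero_biprod (h _ ?_) (h' i ?_)) (e i)
    all_goals simp only [Set.mem_Icc] at hi ⊢; omega
  · exact (isProj k A).prop_of_iso (e i).symm (isProj_biprod k A (hp _) (hp' i))

open Pretriangulated in
instance : (isKbProj k A).IsTriangulatedClosed₃ where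
  ext₃' T hT h₁ h₂ := by
    have h₁' : isBoundedProj k A T.obj₁.as := (isKbProj_quotient_obj_iff k A _).1 h₁
    have h₂' : isBoundedProj k A T.obj₂.as := (isKbProj_quotient_obj_iff k A _).1 h₂
    obtain ⟨f : T.obj₁.as ⟶ T.obj₂.as, hf⟩ :=
      (HomotopyCategory.quotient _ _).map_surjective T.mor₁
    refine ⟨_, ?_, ⟨Triangle.π₃.mapIso (isoTriangleOfIso₁₂ T _ hT
      (HomotopyCategory.mappingCone_triangleh_distinguished f)
      (Iso.refl _) (Iso.refl _) ?_)⟩⟩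
    · exact (isKbProj_quotient_obj_iff k A _).2 (isBoundedProj_mappingCone k A f h₁' h₂')
    · exact ((Category.comp_id _).trans hf.symm).trans (Category.id_comp _).symm

instance : (isKbProj k A).IsTriangulated where
  toIsTriangulatedClosed₂ := .of_isTriangulatedClosed₃

end Categories

section RepresentationType

/-- Two objects are equivalent if they are isomorphic up to a shift. -/
def shiftSetoid (C : Type*) [Category* C] [HasShift C ℤ] : Setoid C where
  r X Y := ∃ n : ℤ, Nonempty (X ≅ Y⟦n⟧)
  iseqv :=
    { refl := fun X => ⟨0, ⟨((shiftFunctorZero C ℤ).app X).symm⟩⟩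
      symm := by
        rintro X Y ⟨n, ⟨e⟩⟩
        exact ⟨-n, ⟨(shiftShiftNeg Y n).symm ≪≫ (shiftFunctor C (-n)).mapIso e.symm⟩⟩
      trans := by
        rintro X Y Z ⟨n, ⟨e⟩⟩ ⟨m, ⟨e'⟩⟩
        exact ⟨m + n, ⟨e ≪≫ (shiftFunctor C n).mapIso e' ≪≫ (shiftAdd Z m n).symm⟩⟩ }

variable {k : Type u} [Field k] {A : Type v} [Ring A] [Algebra k A]

/-- `hl = max {dim_k H^i | i ∈ ℤ}`, for a family `H` of cohomology modules. -/
def cohomologicalLength (H : ℤ → FinDimMod k A) : ℕ :=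
  sSup {n : ℕ | ∃ i : ℤ, n = dim (H i)}

/-- `hw = max {j - i + 1 | H^i ≠ 0 ≠ H^j}`, for a family `H` of cohomology modules. -/
def cohomologicalWidth (H : ℤ → FinDimMod k A) : ℕ :=
  sSup {n : ℕ | ∃ i j : ℤ, (n : ℤ) = j - i + 1 ∧ ¬ IsZero (H i) ∧ ¬ IsZero (H j)}

/-- The cohomological range `hr = hl * hw`, for a family `H` of cohomology modules. -/
def cohomologicalRange (H : ℤ → FinDimMod k A) : ℕ :=
  cohomologicalLength H * cohomologicalWidth H

variable (k A)

/-- `C_m(A-proj)` is of strongly unbounded type. -/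
def MinimalComplexes.StronglyUnbounded (m : ℕ) : Prop :=
  ∃ r : ℕ → ℕ, StrictMono r ∧ ∀ i : ℕ,
    (Quotient.mk (isIsomorphicSetoid (MinimalComplexes k A m)) ''
      {X | Indecomposable X ∧ cohomologicalRange (fun j => X.obj.homology j) = r i}).Infinite

/-- `K^b(A-proj)` is of strongly unbounded type. -/
def HomotopyProj.StronglyUnbounded : Prop :=
  ∃ r : ℕ → ℕ, StrictMono r ∧ ∀ i : ℕ,
    (Quotient.mk (shiftSetoid (HomotopyProj k A)) ''
      {X | Indecomposable X ∧ cohomologicalRange (fun j =>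
        (HomotopyCategory.homologyFunctor (FinDimMod k A) (.up ℤ) j).obj X.obj) = r i}).Infinite

/-- `A` is strongly derived unbounded: the condition on the bounded derived category `D^b(A-mod)`
of the abelian category `A-mod`. The instance `HasDerivedCategory` is Mathlib's choice of a model
for the localization of complexes at quasi-isomorphisms. -/
def StronglyDerivedUnbounded [HasDerivedCategory.{w} (FinDimMod k A)] : Prop :=
  ∃ r : ℕ → ℕ, StrictMono r ∧ ∀ i : ℕ,
    (Quotient.mk (shiftSetoid (DerivedCategory.Bounded (FinDimMod k A))) ''
      {X | Indecomposable X ∧ cohomologicalRange (fun j =>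
        (DerivedCategory.homologyFunctor (FinDimMod k A) j).obj X.obj) = r i}).Infinite

end RepresentationType

end

end DerivedRepType

/-! All three implications transport indecomposables between categories, controlling the cohomology
dimensions and the number of classes that can collapse.

From `C_m(A-proj)` to `K^b(A-proj)`: endomorphism algebras of bounded complexes are
finite-dimensional, so idempotents up to homotopy lift to idempotent chain maps, and these split
inside `C_m(A-proj)`. Indecomposables therefore stay indecomposable. By Nakayama, homotopy
equivalent minimal complexes are isomorphic. Identifying shifts merges only finitely many classes,
since a nonzero complex fits into degrees `0, …, m` for finitely many shifts only.

From `K^b(A-proj)` to `D^b(A-mod)`: bounded complexes of projectives are K-projective, so the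
localization functor is fully faithful here. It preserves cohomology, and indecomposability can be
read off from idempotents.

From `D^b(A-mod)` back to `K^b(A-proj)`: shift an indecomposable `X` of range `r` so that its top
cohomology sits in degree `0`. Successive covers of the top cohomology by free modules
(`exists_trW`) produce a perfect complex `P` with `τ^{≥ -r} P ≅ X` (`exists_truncation_iso`). An
indecomposable summand of `P` still truncates to `X`, and its range lies between `r` and a bound
`R(r)` depending only on `r` and `dim A`. Infinitely many `X` of range `r` thus give infinitely many
summands spread over finitely many ranges, and some range `s ≥ r` occurs infinitely often. As `r` is
arbitrarily large, so is `s`. -/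

namespace DerivedRepType

/-! ### Lifting idempotents, and indecomposability in terms of idempotents -/

section Idempotents

open Polynomial in
/-- Idempotents lift along quotients of algebras that are integral over a field. -/
lemma exists_idempotent_of_isIntegral {k R : Type*} [Field k] [Ring R] [Algebra k R] {x : R}
    (hx : IsIntegral k x) : ∃ e u : R, e * e = e ∧ e - x = u * (x * x - x) := by
  obtain ⟨p, hp, hpx⟩ := hx
  obtain ⟨q, hq, hXq⟩ := exists_eq_pow_rootMultiplicity_mul_and_not_dvd p hp.ne_zero 0
  rw [C_0, sub_zero] at hq hXq
  set n := rootMultiplicity 0 p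
  have hcop : IsCoprime (X ^ (n + 1)) q :=
    (irreducible_X.coprime_iff_not_dvd.2 hXq).pow_left
  -- With `p = X ^ n * q` and `X ∤ q`, the idempotent is `a X ^ (n + 1)`. The exponent `n + 1` makes
  -- it divisible by `X` even when `n = 0`.
  obtain ⟨a, b, hab⟩ := hcop
  have hpx' : aeval x (X ^ n * q) = 0 := by rw [← hq]; exact hpx
  -- The last term vanishes at `x`. It is added so that the polynomial has the root `1`, by the
  -- Bézout identity, as well as the root `0`.
  have hX : (X : k[X]) ∣ a * X ^ (n + 1) - X + b * X * (X ^ n * q) :=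
    ⟨a * X ^ n - 1 + b * (X ^ n * q), by ring⟩
  have hX1 : (X - C 1 : k[X]) ∣ a * X ^ (n + 1) - X + b * X * (X ^ n * q) := by
    rw [dvd_iff_isRoot]
    have := congrArg (eval 1) hab
    simp only [eval_add, eval_mul, eval_pow, eval_X, one_pow, mul_one, eval_one] at this
    simp only [IsRoot, eval_add, eval_sub, eval_mul, eval_pow, eval_X, one_pow, mul_one, one_mul]
    linear_combination this
  have hcop' : IsCoprime (X : k[X]) (X - C 1) := ⟨1, -1, by simp⟩
  obtain ⟨u, hu⟩ := hcop'.mul_dvd hX hX1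
  refine ⟨aeval x (a * X ^ (n + 1)), aeval x u, ?_, ?_⟩
  · have h : a * X ^ (n + 1) * (a * X ^ (n + 1)) =
        a * X ^ (n + 1) - a * X * b * (X ^ n * q) := by
      linear_combination (a * X ^ (n + 1)) * hab
    rw [← map_mul, h, map_sub, map_mul _ (a * X * b), hpx', mul_zero, sub_zero]
  · have h := congrArg (aeval x) hu
    rw [map_add, map_sub, map_mul _ (b * X), hpx', mul_zero, add_zero, aeval_X] at h
    rw [h, mul_comm, map_mul]
    congr 1
    simp [mul_sub]

variable {C : Type*} [Category* C] [Preadditive C]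

/-- A nonzero object whose endomorphism ring has no nontrivial idempotent is indecomposable. -/
lemma indecomposable_of_idempotents [HasBinaryBiproducts C] {X : C} (hX : ¬ IsZero X)
    (h : ∀ e : X ⟶ X, e ≫ e = e → e = 0 ∨ e = 𝟙 X) : Indecomposable X := by
  refine ⟨hX, fun Y Z a => ?_⟩
  rcases h (a.hom ≫ biprod.fst ≫ biprod.inl ≫ a.inv) (by simp) with h | h
  · left
    rw [IsZero.iff_id_eq_zero]
    simpa using congrArg (fun f => biprod.inl ≫ a.inv ≫ f ≫ a.hom ≫ biprod.fst) h
  · right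
    rw [IsZero.iff_id_eq_zero]
    simpa using (congrArg (fun f => biprod.inr ≫ a.inv ≫ f ≫ a.hom ≫ biprod.snd) h).symm

/-- A split idempotent of an indecomposable object is trivial. -/
lemma idempotent_eq_zero_or_id_of_split [HasBinaryBiproducts C] {X Y Z : C}
    (hX : Indecomposable X) {e : X ⟶ X} {i : Y ⟶ X} {r : X ⟶ Y} {i' : Z ⟶ X} {r' : X ⟶ Z}
    (hir : i ≫ r = 𝟙 Y) (hri : r ≫ i = e) (hir' : i' ≫ r' = 𝟙 Z) (hri' : r' ≫ i' = 𝟙 X - e) :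
    e = 0 ∨ e = 𝟙 X := by
  have h₁ : i ≫ r' = 0 := by
    rw [← Category.comp_id (i ≫ r'), ← hir', Category.assoc, reassoc_of% hri', Preadditive.sub_comp,
      Preadditive.comp_sub, Category.id_comp, ← hri, Category.assoc, reassoc_of% hir, sub_self]
  have h₂ : i' ≫ r = 0 := by
    rw [← Category.comp_id (i' ≫ r), ← hir, Category.assoc, reassoc_of% hri]
    have : i' ≫ e = 0 := by
      have : e = 𝟙 X - r' ≫ i' := by rw [hri', sub_sub_cancel]
      rw [this, Preadditive.comp_sub, reassoc_of% hir', Category.comp_id, sub_self]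
    rw [reassoc_of% this, zero_comp]
  have htot : r ≫ i + r' ≫ i' = 𝟙 X := by rw [hri, hri']; abel
  let a : X ≅ Y ⊞ Z :=
    { hom := biprod.lift r r'
      inv := biprod.desc i i'
      hom_inv_id := by simp [htot]
      inv_hom_id := by
        apply biprod.hom_ext <;> apply biprod.hom_ext' <;> simp [hir, hir', h₁, h₂] }
  rcases hX.2 Y Z a with h | h
  · left
    rw [← hri, h.eq_of_tgt r 0, zero_comp]
  · right
    rw [h.eq_of_tgt r' 0, zero_comp] at hri'
    exact (sub_eq_zero.1 hri'.symm).symm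

/-- Trivial idempotents are preserved by full and faithful functors. -/
lemma idempotents_map {D : Type*} [Category* D] [Preadditive D] (F : C ⥤ D) [F.Additive]
    {X : C} (hF : Function.Bijective (F.map : (X ⟶ X) → _))
    (h : ∀ e : X ⟶ X, e ≫ e = e → e = 0 ∨ e = 𝟙 X) (e : F.obj X ⟶ F.obj X) (he : e ≫ e = e) :
    e = 0 ∨ e = 𝟙 _ := by
  obtain ⟨e, rfl⟩ := hF.2 e
  refine (h e (hF.1 (by rw [F.map_comp, he]))).imp ?_ ?_ <;> rintro rfl <;> simp

end Idempotents

/-! ### Splitting homotopy idempotents of bounded complexes -/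

section Complexes

attribute [local instance] ModuleCat.moduleOfAlgebraModule
  ModuleCat.isScalarTower_of_algebra_moduleCat

variable {k : Type u} [Field k] {A : Type v} [Ring A] [Algebra k A]

instance finite_hom (M N : FinDimMod k A) : Module.Finite k (M ⟶ N) := by
  let φ : (M ⟶ N) →ₗ[k] (M.obj →ₗ[k] N.obj) :=
    { toFun f := f.hom.hom.restrictScalars k
      map_add' _ _ := rfl
      map_smul' _ _ := rfl }
  refine Module.Finite.of_injective φ fun f g h => ?_
  ext x
  exact LinearMap.congr_fun h x

/-- Morphisms from a bounded complex form a finite-dimensional space. -/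
lemma finite_hom_of_bounded {X Y : CochainComplex (FinDimMod k A) ℤ} {a b : ℤ}
    (hX : ∀ i, i ∉ Set.Icc a b → IsZero (X.X i)) : Module.Finite k (X ⟶ Y) := by
  let φ : (X ⟶ Y) →ₗ[k] (∀ i : Set.Icc a b, X.X i ⟶ Y.X i) :=
    { toFun f i := f.f i
      map_add' _ _ := rfl
      map_smul' _ _ := rfl }
  refine Module.Finite.of_injective φ fun f g h => ?_
  ext1 i
  by_cases hi : i ∈ Set.Icc a b
  · exact congrFun h ⟨i, hi⟩
  · exact (hX i hi).eq_of_src _ _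

/-- Idempotents up to homotopy of a bounded complex lift to idempotent chain maps. -/
lemma exists_idempotent_lift {X : CochainComplex (FinDimMod k A) ℤ} {a b : ℤ}
    (hX : ∀ i, i ∉ Set.Icc a b → IsZero (X.X i))
    (e : (HomotopyCategory.quotient _ _).obj X ⟶ (HomotopyCategory.quotient _ _).obj X)
    (he : e ≫ e = e) :
    ∃ p : X ⟶ X, p ≫ p = p ∧ (HomotopyCategory.quotient _ _).map p = e := by
  have hfin : Module.Finite k (End X) := finite_hom_of_bounded hX
  obtain ⟨x, rfl⟩ := (HomotopyCategory.quotient _ _).map_surjective e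
  obtain ⟨p, u, hp, hu⟩ := exists_idempotent_of_isIntegral (k := k) (R := End X) (x := x)
    (IsIntegral.of_finite k (B := End X) x)
  refine ⟨p, hp, ?_⟩
  -- The correction `p - x` is a multiple of `x ≫ x - x`, which is null-homotopic. Null-homotopic
  -- endomorphisms need not be nilpotent for this.
  replace hu : (show X ⟶ X from p) - x = (x ≫ x - x) ≫ u := hu
  rw [← sub_eq_zero, ← Functor.map_sub, hu, Functor.map_comp, Functor.map_sub, Functor.map_comp,
    he, sub_self, zero_comp]

lemma isProj_of_retract {M N : FinDimMod k A} (i : M ⟶ N) (r : N ⟶ M) (h : i ≫ r = 𝟙 M)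
    (hN : isProj k A N) : isProj k A M := by
  have : Module.Projective A N.obj := hN
  refine Module.Projective.of_split (M := N.obj) (P := M.obj) i.hom.hom r.hom.hom ?_
  ext x
  exact congrArg (fun g : M ⟶ M => g.hom.hom x) h

lemma isZero_of_retract {D : Type*} [Category* D] [HasZeroMorphisms D] {M N : D}
    (i : M ⟶ N) (r : N ⟶ M) (h : i ≫ r = 𝟙 M) (hN : IsZero N) : IsZero M := by
  rw [IsZero.iff_id_eq_zero, ← h, hN.eq_of_tgt i 0, zero_comp]

section Retract

variable {X Y : CochainComplex (FinDimMod k A) ℤ} {i : Y ⟶ X} {r : X ⟶ Y}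

lemma retract_f (h : i ≫ r = 𝟙 Y) (j : ℤ) : i.f j ≫ r.f j = 𝟙 _ :=
  congrArg (fun f : Y ⟶ Y => f.f j) h

lemma isBoundedProj_of_retract (h : i ≫ r = 𝟙 Y) (hX : isBoundedProj k A X) :
    isBoundedProj k A Y := by
  obtain ⟨⟨a, b, hab⟩, hp⟩ := hX
  exact ⟨⟨a, b, fun j hj => isZero_of_retract _ _ (retract_f h j) (hab j hj)⟩,
    fun j => isProj_of_retract _ _ (retract_f h j) (hp j)⟩

lemma isMinimalProj_of_retract {m : ℕ} (h : i ≫ r = 𝟙 Y) (hX : isMinimalProj k A m X) :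
    isMinimalProj k A m Y := by
  refine ⟨isBoundedProj_of_retract h hX.1, ?_,
    fun j hj => isZero_of_retract _ _ (retract_f h j) (hX.2.2 j hj)⟩
  rintro j _ ⟨y, rfl⟩
  have hd : Y.d j (j + 1) = i.f j ≫ X.d j (j + 1) ≫ r.f (j + 1) := by
    rw [← HomologicalComplex.Hom.comm, ← Category.assoc, retract_f h j, Category.id_comp]
  rw [hd]
  exact range_le_jacobson_of_comp _ _ _ (hX.2.1 j) y

end Retract

/-- Splitting of an idempotent of a complex together with its complement. -/
lemma exists_split {X : CochainComplex (FinDimMod k A) ℤ} {p : X ⟶ X} (hp : p ≫ p = p) :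
    ∃ (Y Z : CochainComplex (FinDimMod k A) ℤ) (i : Y ⟶ X) (r : X ⟶ Y) (i' : Z ⟶ X)
      (r' : X ⟶ Z), i ≫ r = 𝟙 Y ∧ r ≫ i = p ∧ i' ≫ r' = 𝟙 Z ∧ r' ≫ i' = 𝟙 X - p := by
  obtain ⟨Y, i, r, h₁, h₂⟩ := IsIdempotentComplete.idempotents_split X p hp
  obtain ⟨Z, i', r', h₃, h₄⟩ := IsIdempotentComplete.idempotents_split X (𝟙 X - p)
    (by simp [hp])
  exact ⟨Y, Z, i, r, i', r', h₁, h₂, h₃, h₄⟩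

/-- An indecomposable object of `C_m(A-proj)` has no nontrivial idempotent up to homotopy. -/
lemma MinimalComplexes.idempotent_eq {m : ℕ} {X : MinimalComplexes k A m} (hX : Indecomposable X)
    (e : (HomotopyCategory.quotient _ _).obj X.obj ⟶ (HomotopyCategory.quotient _ _).obj X.obj)
    (he : e ≫ e = e) : e = 0 ∨ e = 𝟙 _ := by
  obtain ⟨p, hp, rfl⟩ := exists_idempotent_lift X.property.2.2 e he
  obtain ⟨Y, Z, i, r, i', r', h₁, h₂, h₃, h₄⟩ := exists_split hp
  have := idempotent_eq_zero_or_id_of_split (C := MinimalComplexes k A m) (X := X)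
    (Y := ⟨Y, isMinimalProj_of_retract h₁ X.property⟩)
    (Z := ⟨Z, isMinimalProj_of_retract h₃ X.property⟩) hX
    (e := ObjectProperty.homMk p) (i := ObjectProperty.homMk i) (r := ObjectProperty.homMk r)
    (i' := ObjectProperty.homMk i') (r' := ObjectProperty.homMk r')
    (by ext1; exact h₁) (by ext1; exact h₂) (by ext1; exact h₃) (by ext1; exact h₄)
  refine this.imp (fun h => ?_) fun h => ?_
  · have : p = 0 := congrArg InducedCategory.Hom.hom h
    simp [this]
  · have : p = 𝟙 _ := congrArg InducedCategory.Hom.hom h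
    simp [this]

/-- An indecomposable object of `K^b(A-proj)` has no nontrivial idempotent. -/
lemma HomotopyProj.idempotent_eq {X : HomotopyProj k A} (hX : Indecomposable X)
    (e : X.obj ⟶ X.obj) (he : e ≫ e = e) : e = 0 ∨ e = 𝟙 _ := by
  obtain ⟨X', hX'⟩ := X
  obtain ⟨X', rfl⟩ := X'.quotient_obj_surjective
  have hb := (isKbProj_quotient_obj_iff k A _).1 hX'
  obtain ⟨a, b, hab⟩ := hb.1
  obtain ⟨p, hp, rfl⟩ := exists_idempotent_lift hab e he
  obtain ⟨Y, Z, i, r, i', r', h₁, h₂, h₃, h₄⟩ := exists_split hp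
  let q := HomotopyCategory.quotient (FinDimMod k A) (.up ℤ)
  have := idempotent_eq_zero_or_id_of_split (C := HomotopyProj k A)
    (X := ⟨_, hX'⟩)
    (Y := ⟨q.obj Y, (isKbProj_quotient_obj_iff k A _).2 (isBoundedProj_of_retract h₁ hb)⟩)
    (Z := ⟨q.obj Z, (isKbProj_quotient_obj_iff k A _).2 (isBoundedProj_of_retract h₃ hb)⟩) hX
    (e := ObjectProperty.homMk (q.map p))
    (i := ObjectProperty.homMk (q.map i)) (r := ObjectProperty.homMk (q.map r))
    (i' := ObjectProperty.homMk (q.map i')) (r' := ObjectProperty.homMk (q.map r'))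
    (by ext1; change q.map i ≫ q.map r = 𝟙 _; rw [← q.map_comp, h₁, q.map_id])
    (by ext1; change q.map r ≫ q.map i = q.map p; rw [← q.map_comp, h₂])
    (by ext1; change q.map i' ≫ q.map r' = 𝟙 _; rw [← q.map_comp, h₃, q.map_id])
    (by
      ext1
      change q.map r' ≫ q.map i' = 𝟙 _ - q.map p
      rw [← q.map_comp, h₄, q.map_sub, q.map_id])
  refine this.imp (fun h => ?_) fun h => ?_
  · exact congrArg InducedCategory.Hom.hom h
  · exact congrArg InducedCategory.Hom.hom h

end Complexes

/-! ### The cohomological range as a function of the dimensions -/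

section Range

attribute [local instance] ModuleCat.moduleOfAlgebraModule
  ModuleCat.isScalarTower_of_algebra_moduleCat

variable {k : Type u} [Field k] {A : Type v} [Ring A] [Algebra k A]

lemma dim_congr {M N : FinDimMod k A} (e : M ≅ N) : dim M = dim N :=
  (((isFinDim k A).ι.mapIso e).toLinearEquiv.restrictScalars k).finrank_eq

lemma isZero_iff_dim_eq_zero (M : FinDimMod k A) : IsZero M ↔ dim M = 0 := by
  rw [dim, Module.finrank_zero_iff]
  refine ⟨fun h => ModuleCat.subsingleton_of_isZero ((isFinDim k A).ι.map_isZero h), fun h => ?_⟩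
  rw [IsZero.iff_id_eq_zero]
  ext x
  exact Subsingleton.elim _ _

variable {H H' : ℤ → FinDimMod k A}

lemma cohomologicalRange_congr (h : ∀ i, dim (H i) = dim (H' i)) :
    cohomologicalRange H = cohomologicalRange H' := by
  simp only [cohomologicalRange, cohomologicalLength, cohomologicalWidth, isZero_iff_dim_eq_zero, h]

lemma cohomologicalRange_shift (n : ℤ) (h : ∀ i, dim (H' i) = dim (H (i + n))) :
    cohomologicalRange H' = cohomologicalRange H := by
  have h₁ : cohomologicalLength H' = cohomologicalLength H := by
    unfold cohomologicalLength
    congr 1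
    ext l
    exact ⟨fun ⟨i, hi⟩ => ⟨i + n, hi.trans (h i)⟩,
      fun ⟨i, hi⟩ => ⟨i - n, by rw [hi, h, sub_add_cancel]⟩⟩
  have h₂ : cohomologicalWidth H' = cohomologicalWidth H := by
    simp only [cohomologicalWidth, isZero_iff_dim_eq_zero, h]
    congr 1
    ext l
    exact ⟨fun ⟨i, j, hl, hi, hj⟩ => ⟨i + n, j + n, by lia, hi, hj⟩,
      fun ⟨i, j, hl, hi, hj⟩ => ⟨i - n, j - n, by lia, by simpa using hi, by simpa using hj⟩⟩
  rw [cohomologicalRange, h₁, h₂, cohomologicalRange]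

section Bounded

variable {a b : ℤ} (hH : ∀ i, i ∉ Set.Icc a b → dim (H i) = 0)
include hH

/-- Bounded support is essential: the `sSup` of an unbounded set of natural numbers is `0`. -/
lemma dim_le_cohomologicalLength (i : ℤ) : dim (H i) ≤ cohomologicalLength H := by
  refine le_csSup ?_ ⟨i, rfl⟩
  refine ((Set.toFinite ((fun i => dim (H i)) '' Set.Icc a b)).union
    (Set.finite_singleton 0)).bddAbove.mono ?_
  rintro _ ⟨i, rfl⟩
  by_cases hi : i ∈ Set.Icc a b
  · exact Or.inl ⟨i, hi, rfl⟩
  · exact Or.inr (hH i hi)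

lemma sub_add_one_le_cohomologicalWidth {i j : ℤ} (hi : dim (H i) ≠ 0) (hj : dim (H j) ≠ 0) :
    j - i + 1 ≤ cohomologicalWidth H := by
  rcases le_or_gt (j - i + 1) 0 with h | h
  · exact h.trans (by positivity)
  · have : (j - i + 1).toNat ≤ cohomologicalWidth H := by
      refine le_csSup ⟨(b - a + 1).toNat, ?_⟩
        ⟨i, j, by lia, by rwa [isZero_iff_dim_eq_zero], by rwa [isZero_iff_dim_eq_zero]⟩
      rintro n ⟨i, j, hn, hi, hj⟩
      rw [isZero_iff_dim_eq_zero] at hi hj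
      have hi' := not_imp_comm.1 (hH i) hi
      have hj' := not_imp_comm.1 (hH j) hj
      simp only [Set.mem_Icc] at hi' hj'
      lia
    lia

lemma cohomologicalLength_pos {i : ℤ} (hi : dim (H i) ≠ 0) : 0 < cohomologicalLength H :=
  (Nat.pos_of_ne_zero hi).trans_le (dim_le_cohomologicalLength hH i)

/-- The width is at least `1` as soon as some cohomology is nonzero, so the product dominates the
length. -/
lemma dim_le_cohomologicalRange (i : ℤ) : dim (H i) ≤ cohomologicalRange H := by
  by_cases hi : dim (H i) = 0
  · simp [hi]
  · refine (dim_le_cohomologicalLength hH i).trans (Nat.le_mul_of_pos_right _ ?_)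
    have := sub_add_one_le_cohomologicalWidth hH hi hi
    lia

lemma sub_add_one_le_cohomologicalRange {i j : ℤ} (hi : dim (H i) ≠ 0) (hj : dim (H j) ≠ 0) :
    j - i + 1 ≤ cohomologicalRange H := by
  have := sub_add_one_le_cohomologicalWidth hH hi hj
  have : cohomologicalWidth H ≤ cohomologicalRange H :=
    Nat.le_mul_of_pos_left _ (cohomologicalLength_pos hH hi)
  lia

lemma cohomologicalRange_le {l : ℕ} (hl : ∀ i, dim (H i) ≤ l) :
    cohomologicalRange H ≤ l * (b - a + 1).toNat := by
  refine Nat.mul_le_mul ?_ ?_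
  · exact csSup_le' (by rintro _ ⟨i, rfl⟩; exact hl i)
  · refine csSup_le' ?_
    rintro n ⟨i, j, hn, hi, hj⟩
    rw [isZero_iff_dim_eq_zero] at hi hj
    have hi' := not_imp_comm.1 (hH i) hi
    have hj' := not_imp_comm.1 (hH j) hj
    simp only [Set.mem_Icc] at hi' hj'
    lia

lemma cohomologicalRange_mono (h : ∀ i, dim (H' i) ≤ dim (H i)) :
    cohomologicalRange H' ≤ cohomologicalRange H := by
  refine Nat.mul_le_mul ?_ ?_
  · refine csSup_le' ?_
    rintro _ ⟨i, rfl⟩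
    exact (h i).trans (dim_le_cohomologicalLength hH i)
  · refine csSup_le' ?_
    rintro n ⟨i, j, hn, hi, hj⟩
    rw [isZero_iff_dim_eq_zero] at hi hj
    have hi' := h i
    have hj' := h j
    have := sub_add_one_le_cohomologicalWidth hH (i := i) (j := j) (by lia) (by lia)
    lia

end Bounded

end Range

/-! ### Rigidity of homotopy minimal complexes -/

section Minimal

attribute [local instance] ModuleCat.moduleOfAlgebraModule
  ModuleCat.isScalarTower_of_algebra_moduleCat

variable {k : Type u} [Field k] {A : Type v} [Ring A] [Algebra k A]

/-- Nakayama: an endomorphism congruent to the identity modulo the radical is invertible. -/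
lemma isIso_of_sub_mem_jacobson {M : FinDimMod k A} (f : M ⟶ M)
    (hf : ∀ x, f.hom.hom x - x ∈ Module.jacobson A M.obj) : IsIso f := by
  have : Module.Finite A M.obj := Module.Finite.of_restrictScalars_finite k A M.obj
  have hs : Function.Surjective f.hom.hom := by
    rw [← LinearMap.range_eq_top]
    by_contra h
    -- A maximal submodule `N` containing the image also contains the radical, hence every `x = f x
    -- - (f x - x)`.
    obtain ⟨N, hN, hle⟩ := (eq_top_or_exists_le_coatom (LinearMap.range f.hom.hom)).resolve_left h
    refine hN.1 (eq_top_iff.2 fun x _ => ?_)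
    have h₁ : f.hom.hom x - x ∈ N := (sInf_le hN : Module.jacobson A M.obj ≤ N) (hf x)
    have h₂ : f.hom.hom x ∈ N := hle ⟨x, rfl⟩
    simpa using sub_mem h₂ h₁
  have hi : Function.Injective f.hom.hom :=
    LinearMap.injective_iff_surjective (f := f.hom.hom.restrictScalars k) |>.2 hs
  let e := LinearEquiv.ofBijective f.hom.hom ⟨hi, hs⟩
  refine ⟨ObjectProperty.homMk (ModuleCat.ofHom e.symm.toLinearMap), ?_, ?_⟩
  · ext x
    exact e.symm_apply_apply x
  · ext x
    exact e.apply_symm_apply x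

/-- An endomorphism of a homotopy minimal complex that is homotopic to the identity is
invertible. -/
lemma IsHomotopyMinimal.isIso_of_homotopy {X : CochainComplex (FinDimMod k A) ℤ}
    (hX : IsHomotopyMinimal X) {f : X ⟶ X} (h : Homotopy f (𝟙 X)) : IsIso f := by
  have (i : ℤ) : IsIso (f.f i) := by
    refine isIso_of_sub_mem_jacobson _ fun x => ?_
    obtain ⟨j, rfl⟩ : ∃ j, i = j + 1 := ⟨i - 1, by simp⟩
    have h₁ := h.comm (j + 1)
    rw [dNext_eq h.hom (show (ComplexShape.up ℤ).Rel (j + 1) (j + 1 + 1) from rfl),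
      prevD_eq h.hom (show (ComplexShape.up ℤ).Rel j (j + 1) from rfl)] at h₁
    -- Both terms of the homotopy formula pass through a differential, whose image is radical, and
    -- module maps preserve radicals.
    have h₂ : f.f (j + 1) - 𝟙 _ = 𝟙 _ ≫ X.d (j + 1) (j + 1 + 1) ≫ h.hom _ _ +
        h.hom (j + 1) j ≫ X.d j (j + 1) ≫ 𝟙 _ := by
      rw [h₁]; simp
    have h₄ := congrArg (fun g => g.hom.hom x) h₂
    change (f.f (j + 1)).hom.hom x - x = _ at h₄
    rw [h₄]
    exact add_mem (range_le_jacobson_of_comp _ _ _ (hX _) x)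
      (range_le_jacobson_of_comp _ _ _ (hX _) x)
  exact HomologicalComplex.Hom.isIso_of_components f

/-- Homotopy equivalent homotopy minimal complexes are isomorphic. -/
lemma nonempty_iso_of_homotopyCategory_iso {X Y : CochainComplex (FinDimMod k A) ℤ}
    (hX : IsHomotopyMinimal X) (hY : IsHomotopyMinimal Y)
    (e : (HomotopyCategory.quotient _ (.up ℤ)).obj X ≅
      (HomotopyCategory.quotient _ (.up ℤ)).obj Y) :
    Nonempty (X ≅ Y) := by
  let e' := HomotopyCategory.homotopyEquivOfIso e
  have h₁ := hX.isIso_of_homotopy e'.homotopyHomInvId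
  have h₂ := hY.isIso_of_homotopy e'.homotopyInvHomId
  have : Mono e'.hom := mono_of_mono e'.hom e'.inv
  have : IsSplitEpi e'.hom :=
    .mk' ⟨inv (e'.inv ≫ e'.hom) ≫ e'.inv, by rw [Category.assoc, IsIso.inv_hom_id]⟩
  have := isIso_of_mono_of_isSplitEpi e'.hom
  exact ⟨asIso e'.hom⟩

end Minimal

/-! ### Cohomology detects zero objects of `K^b(A-proj)` -/

section HomotopyProj

variable {k : Type u} [Field k] {A : Type v} [Ring A] [Algebra k A]

/-- The module cokernel is again finite-dimensional, so an epimorphism of `A-mod` can be tested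
against it. -/
lemma surjective_of_epi {E X : FinDimMod k A} (e : E ⟶ X) [Epi e] :
    Function.Surjective e.hom.hom := by
  rw [← LinearMap.range_eq_top]
  by_contra h
  let Q : FinDimMod k A := ⟨ModuleCat.of A (X.obj ⧸ LinearMap.range e.hom.hom),
    isFinDim_of_surjective k A (Submodule.mkQ _) (Submodule.mkQ_surjective _) X.property⟩
  let π : X ⟶ Q := ObjectProperty.homMk (ModuleCat.ofHom (Submodule.mkQ _))
  have h₁ : e ≫ π = e ≫ 0 := by
    ext x
    exact (Submodule.Quotient.mk_eq_zero _).2 ⟨x, rfl⟩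
  have h₂ : π = 0 := (cancel_epi e).1 h₁
  refine h (eq_top_iff.2 fun x _ => (Submodule.Quotient.mk_eq_zero _).1 ?_)
  exact congrArg (fun g : X ⟶ Q => g.hom.hom x) h₂

lemma projective_of_isProj {M : FinDimMod k A} (hM : isProj k A M) : Projective M where
  factors {E X} f e _ := by
    have hP : Module.Projective A M.obj := hM
    have hs := surjective_of_epi e
    obtain ⟨g, hg⟩ := Module.projective_lifting_property e.hom.hom f.hom.hom hs
    refine ⟨ObjectProperty.homMk (ModuleCat.ofHom g), ?_⟩
    ext x
    exact LinearMap.congr_fun hg x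

lemma isKProjective_of_isBoundedProj {X : CochainComplex (FinDimMod k A) ℤ}
    (hX : isBoundedProj k A X) : X.IsKProjective := by
  obtain ⟨⟨a, b, hab⟩, hp⟩ := hX
  have (i : ℤ) : Projective (X.X i) := projective_of_isProj (hp i)
  have : X.IsStrictlyLE b := by
    rw [CochainComplex.isStrictlyLE_iff]
    exact fun i hi => hab i (by simp only [Set.mem_Icc]; lia)
  exact CochainComplex.isKProjective_of_projective X b

/-- The cohomology of an object of `K^b(A-proj)`. -/
noncomputable abbrev HomotopyProj.cohomology (X : HomotopyProj k A) (j : ℤ) : FinDimMod k A :=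
  (HomotopyCategory.homologyFunctor (FinDimMod k A) (.up ℤ) j).obj X.obj

/-- An acyclic K-projective complex has null-homotopic identity. -/
lemma HomotopyProj.isZero_of_cohomology {X : HomotopyProj k A}
    (h : ∀ j, dim (X.cohomology j) = 0) : IsZero X := by
  obtain ⟨X, hX⟩ := X
  obtain ⟨X, rfl⟩ := X.quotient_obj_surjective
  have := isKProjective_of_isBoundedProj ((isKbProj_quotient_obj_iff k A _).1 hX)
  have hac : HomologicalComplex.Acyclic X := fun j => by
    rw [HomologicalComplex.exactAt_iff_isZero_homology]
    exact ((isZero_iff_dim_eq_zero _).2 (h j)).of_iso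
      ((HomotopyCategory.homologyFunctorFactors _ _ j).app X).symm
  rw [IsZero.iff_id_eq_zero]
  ext1
  have := HomotopyCategory.eq_of_homotopy _ _
    (CochainComplex.IsKProjective.homotopyZero (𝟙 X) hac)
  rwa [CategoryTheory.Functor.map_id, Functor.map_zero] at this

lemma HomotopyProj.exists_bounds (X : HomotopyProj k A) :
    ∃ a b : ℤ, ∀ j, j ∉ Set.Icc a b → dim (X.cohomology j) = 0 := by
  obtain ⟨X, hX⟩ := X
  obtain ⟨X, rfl⟩ := X.quotient_obj_surjective
  obtain ⟨⟨a, b, hab⟩, -⟩ := (isKbProj_quotient_obj_iff k A _).1 hX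
  refine ⟨a, b, fun j hj => (isZero_iff_dim_eq_zero _).1 ?_⟩
  exact (ShortComplex.isZero_homology_of_isZero_X₂ _ (hab j hj)).of_iso
    ((HomotopyCategory.homologyFunctorFactors _ _ j).app X)

lemma HomotopyProj.exists_cohomology_ne_zero {X : HomotopyProj k A} (hX : ¬ IsZero X) :
    ∃ j, dim (X.cohomology j) ≠ 0 := by
  by_contra! h
  exact hX (isZero_of_cohomology h)

lemma HomotopyProj.dim_cohomology_congr {X Y : HomotopyProj k A} (e : X ≅ Y) (j : ℤ) :
    dim (X.cohomology j) = dim (Y.cohomology j) :=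
  dim_congr ((HomotopyCategory.homologyFunctor _ _ j).mapIso ((isKbProj k A).ι.mapIso e))

lemma HomotopyProj.dim_cohomology_shift (X : HomotopyProj k A) (n j : ℤ) :
    dim (HomotopyProj.cohomology (X⟦n⟧) j) = dim (X.cohomology (j + n)) :=
  (dim_congr ((HomotopyCategory.homologyFunctor _ _ j).mapIso
    (((isKbProj k A).ι.commShiftIso n).app X))).trans
    (dim_congr (((HomotopyCategory.homologyFunctor (FinDimMod k A) (.up ℤ) 0).shiftIso n j (j + n)
      (add_comm _ _)).app X.obj))

end HomotopyProj

/-! ### From `C_m(A-proj)` to `K^b(A-proj)` -/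

section Minimal

variable {k : Type u} [Field k] {A : Type v} [Ring A] [Algebra k A]

/-- An object of `C_m(A-proj)` considered in `K^b(A-proj)`. -/
noncomputable abbrev MinimalComplexes.toHomotopyProj {m : ℕ} (X : MinimalComplexes k A m) :
    HomotopyProj k A :=
  ⟨(HomotopyCategory.quotient _ _).obj X.obj, (isKbProj_quotient_obj_iff k A _).2 X.property.1⟩

variable {m : ℕ}

lemma MinimalComplexes.dim_cohomology (X : MinimalComplexes k A m) (j : ℤ) :
    dim (X.toHomotopyProj.cohomology j) = dim (X.obj.homology j) :=
  dim_congr ((HomotopyCategory.homologyFunctorFactors _ _ j).app X.obj)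

lemma MinimalComplexes.dim_cohomology_eq_zero (X : MinimalComplexes k A m) {j : ℤ}
    (hj : j ∉ Set.Icc (0 : ℤ) m) : dim (X.toHomotopyProj.cohomology j) = 0 := by
  rw [X.dim_cohomology, ← isZero_iff_dim_eq_zero]
  exact ShortComplex.isZero_homology_of_isZero_X₂ _ (X.property.2.2 j hj)

lemma MinimalComplexes.nonempty_iso {X Y : MinimalComplexes k A m}
    (e : X.toHomotopyProj ≅ Y.toHomotopyProj) : Nonempty (X ≅ Y) := by
  obtain ⟨e'⟩ := nonempty_iso_of_homotopyCategory_iso X.property.2.1 Y.property.2.1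
    ((isKbProj k A).ι.mapIso e)
  exact ⟨(isMinimalProj k A m).isoMk e'⟩

/-- A contractible minimal complex is zero, because its zero endomorphism is homotopic to the
identity and hence invertible. Idempotents are handled by lifting. -/
lemma MinimalComplexes.indecomposable_toHomotopyProj {X : MinimalComplexes k A m}
    (hX : Indecomposable X) : Indecomposable X.toHomotopyProj := by
  refine indecomposable_of_idempotents (fun h => hX.1 ?_) fun e he => ?_
  · have h₁ : (HomotopyCategory.quotient _ _).map (0 : X.obj ⟶ X.obj) =
        (HomotopyCategory.quotient _ _).map (𝟙 X.obj) :=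
      ((isKbProj k A).ι.map_isZero h).eq_of_src _ _
    have : IsIso (0 : X.obj ⟶ X.obj) :=
      X.property.2.1.isIso_of_homotopy (HomotopyCategory.homotopyOfEq _ _ h₁)
    rw [IsZero.iff_id_eq_zero]
    ext1
    exact (cancel_epi (0 : X.obj ⟶ X.obj)).1 (zero_comp.trans zero_comp.symm)
  · refine (MinimalComplexes.idempotent_eq hX e.hom (congrArg InducedCategory.Hom.hom he)).imp
      (fun h => ?_) fun h => ?_
    all_goals ext1; exact h

variable (k A) in
/-- If `C_m(A-proj)` is of strongly unbounded type, then so is `K^b(A-proj)`. -/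
theorem HomotopyProj.stronglyUnbounded_of_minimalComplexes
    (h : MinimalComplexes.StronglyUnbounded k A m) : HomotopyProj.StronglyUnbounded k A := by
  obtain ⟨r, hr, h⟩ := h
  refine ⟨r, hr, fun i hfin => h i ?_⟩
  let f : Quotient (isIsomorphicSetoid (MinimalComplexes k A m)) →
      Quotient (shiftSetoid (HomotopyProj k A)) :=
    Quotient.map MinimalComplexes.toHomotopyProj (by
      rintro X Y ⟨e⟩
      refine ⟨0, ⟨(isKbProj k A).isoMk ?_ ≪≫ ((shiftFunctorZero _ ℤ).app _).symm⟩⟩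
      exact (HomotopyCategory.quotient _ _).mapIso ((isMinimalProj k A m).ι.mapIso e))
  refine Set.Finite.of_finite_fibers f (hfin.subset ?_) ?_
  · rintro _ ⟨_, ⟨X, ⟨hX, hXr⟩, rfl⟩, rfl⟩
    exact ⟨X.toHomotopyProj, ⟨MinimalComplexes.indecomposable_toHomotopyProj hX,
      (cohomologicalRange_congr X.dim_cohomology).trans hXr⟩, rfl⟩
  · rintro _ ⟨_, ⟨Y, ⟨hY, -⟩, rfl⟩, rfl⟩
    obtain ⟨j, hj⟩ := HomotopyProj.exists_cohomology_ne_zero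
      (MinimalComplexes.indecomposable_toHomotopyProj hY).1
    have hj' := not_imp_comm.1 Y.dim_cohomology_eq_zero hj
    have key : ∀ x : Quotient (isIsomorphicSetoid (MinimalComplexes k A m)), f x = f (.mk _ Y) →
        ∃ (n : ℤ) (X : MinimalComplexes k A m), x = .mk _ X ∧
          Nonempty (X.toHomotopyProj ≅ Y.toHomotopyProj⟦n⟧) := by
      rintro ⟨X⟩ hx
      obtain ⟨n, e⟩ := Quotient.exact hx
      exact ⟨n, X, rfl, e⟩
    choose! n key using key
    choose X hX e using key
    -- A class in the fibre over `Y` is determined by its shift `n`, by minimality. A nonzero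
    -- `H^j(Y)` appears in degree `j - n` of the other complex; both degrees lie in `0, …, m`, so
    -- `|n| ≤ m`.
    refine Set.Finite.of_injOn (f := n) (t := Set.Icc (-m : ℤ) m) ?_ ?_ (Set.finite_Icc _ _)
    · rintro x ⟨-, hx⟩
      obtain ⟨e⟩ := e x hx
      have h₁ : dim ((X x hx).toHomotopyProj.cohomology (j - n x)) ≠ 0 := by
        rwa [HomotopyProj.dim_cohomology_congr e, HomotopyProj.dim_cohomology_shift,
          sub_add_cancel]
      have h₂ := not_imp_comm.1 (X x hx).dim_cohomology_eq_zero h₁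
      simp only [Set.mem_Icc] at h₂ hj' ⊢
      lia
    · rintro x ⟨-, hx⟩ y ⟨-, hy⟩ hxy
      obtain ⟨e₁⟩ := e x hx
      obtain ⟨e₂⟩ := e y hy
      rw [hX x hx, hX y hy]
      rw [← hxy] at e₂
      exact Quotient.sound (MinimalComplexes.nonempty_iso (e₁ ≪≫ e₂.symm))

end Minimal

/-! ### From `K^b(A-proj)` to `D^b(A-mod)` -/

section Derived

variable {k : Type u} [Field k] {A : Type v} [Ring A] [Algebra k A]
  [HasDerivedCategory.{w} (FinDimMod k A)]

open DerivedCategory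

/-- The cohomology of an object of `D^b(A-mod)`. -/
noncomputable abbrev cohomology (X : DerivedCategory (FinDimMod k A)) (j : ℤ) : FinDimMod k A :=
  (DerivedCategory.homologyFunctor (FinDimMod k A) j).obj X

lemma dim_cohomology_congr {X Y : DerivedCategory (FinDimMod k A)} (e : X ≅ Y) (j : ℤ) :
    dim (cohomology X j) = dim (cohomology Y j) :=
  dim_congr ((DerivedCategory.homologyFunctor _ j).mapIso e)

lemma dim_cohomology_shift (X : DerivedCategory (FinDimMod k A)) (n j : ℤ) :
    dim (cohomology (X⟦n⟧) j) = dim (cohomology X (j + n)) :=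
  dim_congr (((DerivedCategory.homologyFunctor (FinDimMod k A) 0).shiftIso n j (j + n)
    (add_comm _ _)).app X)

lemma dim_cohomology_Qh (X : HomotopyCategory (FinDimMod k A) (.up ℤ)) (j : ℤ) :
    dim (cohomology (Qh.obj X) j) = dim ((HomotopyCategory.homologyFunctor _ _ j).obj X) :=
  dim_congr ((DerivedCategory.homologyFunctorFactorsh _ j).app X)

lemma bounded_iff (X : DerivedCategory (FinDimMod k A)) :
    TStructure.t.bounded X ↔ ∃ a b : ℤ, ∀ j, j ∉ Set.Icc a b → dim (cohomology X j) = 0 := by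
  constructor
  · rintro ⟨⟨a, ha⟩, b, hb⟩
    have : X.IsGE a := ha
    have : X.IsLE b := hb
    refine ⟨a, b, fun j hj => (isZero_iff_dim_eq_zero _).1 ?_⟩
    rcases lt_or_ge j a with h | h
    · exact isZero_of_isGE X a j h
    · exact isZero_of_isLE X b j (by simp only [Set.mem_Icc] at hj; lia)
  · rintro ⟨a, b, h⟩
    have h₁ : X.IsGE a := (isGE_iff X a).2 fun j hj =>
      (isZero_iff_dim_eq_zero _).2 (h j (by simp only [Set.mem_Icc]; lia))
    have h₂ : X.IsLE b := (isLE_iff X b).2 fun j hj =>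
      (isZero_iff_dim_eq_zero _).2 (h j (by simp only [Set.mem_Icc]; lia))
    exact ⟨⟨a, h₁⟩, b, h₂⟩

/-- An object of `K^b(A-proj)` considered in `D^b(A-mod)`. -/
noncomputable abbrev HomotopyProj.toBounded (X : HomotopyProj k A) : Bounded (FinDimMod k A) :=
  ⟨Qh.obj X.obj, (bounded_iff _).2 (by
    simp only [dim_cohomology_Qh]
    exact X.exists_bounds)⟩

lemma HomotopyProj.Qh_map_bijective (X Y : HomotopyProj k A) :
    Function.Bijective (Qh.map : (X.obj ⟶ Y.obj) → _) := by
  obtain ⟨X, hX⟩ := X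
  obtain ⟨X, rfl⟩ := X.quotient_obj_surjective
  have := isKProjective_of_isBoundedProj ((isKbProj_quotient_obj_iff k A _).1 hX)
  exact CochainComplex.IsKProjective.Qh_map_bijective X Y.obj

lemma HomotopyProj.nonempty_iso {X Y : HomotopyProj k A} (e : Qh.obj X.obj ≅ Qh.obj Y.obj) :
    Nonempty (X ≅ Y) := by
  obtain ⟨f, hf⟩ := (Qh_map_bijective X Y).2 e.hom
  obtain ⟨g, hg⟩ := (Qh_map_bijective Y X).2 e.inv
  refine ⟨(isKbProj k A).isoMk ⟨f, g, (Qh_map_bijective X X).1 ?_, (Qh_map_bijective Y Y).1 ?_⟩⟩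
  all_goals simp [hf, hg]

/-- A summand in `D^b(A-mod)` need not visibly come from `K^b(A-proj)`, but its idempotent does, by
full faithfulness. -/
lemma HomotopyProj.indecomposable_toBounded {X : HomotopyProj k A} (hX : Indecomposable X) :
    Indecomposable X.toBounded := by
  refine indecomposable_of_idempotents (fun h => hX.1 (isZero_of_cohomology fun j => ?_))
    fun e he => ?_
  · rw [← dim_cohomology_Qh, ← isZero_iff_dim_eq_zero]
    exact (DerivedCategory.homologyFunctor _ j).map_isZero ((TStructure.t.bounded).ι.map_isZero h)
  · refine (idempotents_map Qh (Qh_map_bijective X X) (HomotopyProj.idempotent_eq hX) e.hom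
      (congrArg InducedCategory.Hom.hom he)).imp (fun h => ?_) fun h => ?_
    all_goals ext1; exact h

variable (k A) in
/-- If `K^b(A-proj)` is of strongly unbounded type, then `A` is strongly derived unbounded. -/
theorem stronglyDerivedUnbounded_of_homotopyProj (h : HomotopyProj.StronglyUnbounded k A) :
    StronglyDerivedUnbounded.{w} k A := by
  obtain ⟨r, hr, h⟩ := h
  have comm (X : HomotopyProj k A) (n : ℤ) :
      Nonempty (X⟦n⟧.toBounded ≅ X.toBounded⟦n⟧) :=
    ⟨TStructure.t.bounded.isoMk (Qh.mapIso (((isKbProj k A).ι.commShiftIso n).app X) ≪≫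
      (Qh.commShiftIso n).app X.obj ≪≫
      ((TStructure.t.bounded.ι.commShiftIso n).app X.toBounded).symm)⟩
  refine ⟨r, hr, fun i => ?_⟩
  let f : Quotient (shiftSetoid (HomotopyProj k A)) →
      Quotient (shiftSetoid (Bounded (FinDimMod k A))) :=
    Quotient.map HomotopyProj.toBounded (by
      rintro X Y ⟨n, ⟨e⟩⟩
      obtain ⟨c⟩ := comm Y n
      refine ⟨n, ⟨TStructure.t.bounded.isoMk ?_ ≪≫ c⟩⟩
      exact Qh.mapIso ((isKbProj k A).ι.mapIso e))
  have hf : Function.Injective f := by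
    rintro ⟨X⟩ ⟨Y⟩ hXY
    obtain ⟨n, ⟨e⟩⟩ := Quotient.exact hXY
    obtain ⟨c⟩ := comm Y n
    exact Quotient.sound ⟨n, HomotopyProj.nonempty_iso
      (TStructure.t.bounded.ι.mapIso (e ≪≫ c.symm))⟩
  refine ((h i).image hf.injOn).mono ?_
  rintro _ ⟨_, ⟨X, ⟨hX, hXr⟩, rfl⟩, rfl⟩
  exact ⟨X.toBounded, ⟨HomotopyProj.indecomposable_toBounded hX,
    (cohomologicalRange_congr (dim_cohomology_Qh X.obj)).trans hXr⟩, rfl⟩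

end Derived

/-! ### Dimension estimates in `A-mod` -/

section Dimension

attribute [local instance] ModuleCat.moduleOfAlgebraModule
  ModuleCat.isScalarTower_of_algebra_moduleCat

variable {k : Type u} [Field k] {A : Type v} [Ring A] [Algebra k A]

lemma dim_biprod (M N : FinDimMod k A) : dim (M ⊞ N) = dim M + dim N := by
  let p : M ⊞ N ⟶ M := biprod.fst
  let q : M ⊞ N ⟶ N := biprod.snd
  let i : M ⟶ M ⊞ N := biprod.inl
  let j : N ⟶ M ⊞ N := biprod.inr
  let e : (M ⊞ N).obj ≃ₗ[k] M.obj × N.obj :=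
    { (LinearMap.prod p.hom.hom q.hom.hom).restrictScalars k with
      invFun x := i.hom.hom x.1 + j.hom.hom x.2
      left_inv x := congrArg (fun g : M ⊞ N ⟶ M ⊞ N => g.hom.hom x) biprod.total
      right_inv := by
        rintro ⟨x, y⟩
        have h₁ : p.hom.hom (i.hom.hom x) = x :=
          congrArg (fun g => g.hom.hom x) (biprod.inl_fst (X := M) (Y := N))
        have h₂ : q.hom.hom (i.hom.hom x) = 0 :=
          congrArg (fun g => g.hom.hom x) (biprod.inl_snd (X := M) (Y := N))
        have h₃ : p.hom.hom (j.hom.hom y) = 0 :=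
          congrArg (fun g => g.hom.hom y) (biprod.inr_fst (X := M) (Y := N))
        have h₄ : q.hom.hom (j.hom.hom y) = y :=
          congrArg (fun g => g.hom.hom y) (biprod.inr_snd (X := M) (Y := N))
        refine Prod.ext ?_ ?_
        · change p.hom.hom (i.hom.hom x + j.hom.hom y) = x
          rw [map_add, h₁, h₃, add_zero]
        · change q.hom.hom (i.hom.hom x + j.hom.hom y) = y
          rw [map_add, h₂, h₄, zero_add] }
  exact e.finrank_eq.trans (Module.finrank_prod ..)

lemma dim_le_of_exact {S : ShortComplex (FinDimMod k A)} (hS : S.Exact) :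
    dim S.X₂ ≤ dim S.X₁ + dim S.X₃ := by
  have hle : LinearMap.ker S.g.hom.hom ≤ LinearMap.range S.f.hom.hom := by
    intro x hx
    let K : FinDimMod k A := ⟨ModuleCat.of A (LinearMap.ker S.g.hom.hom),
      isFinDim_of_injective k A (Submodule.subtype _) Subtype.val_injective S.X₂.property⟩
    let ι : K ⟶ S.X₂ := ObjectProperty.homMk (ModuleCat.ofHom (Submodule.subtype _))
    have hι : ι ≫ S.g = 0 := by
      ext y
      exact y.2
    have := hS.epi_toCycles
    obtain ⟨y, hy⟩ := surjective_of_epi S.toCycles ((S.liftCycles ι hι).hom.hom ⟨x, hx⟩)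
    refine ⟨y, ?_⟩
    have h₁ := congrArg (fun g => g.hom.hom y) S.toCycles_i
    have h₂ := congrArg (fun g => g.hom.hom (⟨x, hx⟩ : LinearMap.ker S.g.hom.hom))
      (S.liftCycles_i ι hι)
    change S.iCycles.hom.hom (S.toCycles.hom.hom y) = _ at h₁
    change S.iCycles.hom.hom ((S.liftCycles ι hι).hom.hom ⟨x, hx⟩) = x at h₂
    rw [← h₁, hy, h₂]
  let f : S.X₁.obj →ₗ[k] S.X₂.obj := S.f.hom.hom.restrictScalars k
  let g : S.X₂.obj →ₗ[k] S.X₃.obj := S.g.hom.hom.restrictScalars k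
  have h₁ := g.finrank_range_add_finrank_ker
  have h₂ : Module.finrank k (LinearMap.ker g) ≤ Module.finrank k (LinearMap.range f) :=
    Submodule.finrank_mono (fun x hx => hle hx)
  have h₃ := f.finrank_range_le
  have h₄ := (LinearMap.range g).finrank_le
  change Module.finrank k S.X₂.obj ≤ Module.finrank k S.X₁.obj + Module.finrank k S.X₃.obj
  lia

lemma finite_and_finrank_of_linearEquiv {V : Type*} [AddCommGroup V] [Module A V] [Module k V]
    [IsScalarTower k A V] [Module.Finite k V] {F : ModuleCat.{v} A} (e : V ≃ₗ[A] F) :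
    Module.Finite k F ∧ Module.finrank k F = Module.finrank k V :=
  ⟨Module.Finite.equiv (e.restrictScalars k), (e.restrictScalars k).finrank_eq.symm⟩

/-- Every module of finite dimension `d` is a quotient of the free module of rank `d`. -/
lemma exists_projective_cover [Module.Finite k A] (M : FinDimMod k A) :
    ∃ (G : FinDimMod k A) (π : G ⟶ M), isProj k A G ∧ Epi π ∧
      dim G ≤ Module.finrank k A * dim M := by
  let d := dim M
  obtain ⟨hF, hFd⟩ := finite_and_finrank_of_linearEquiv (k := k) (F := ModuleCat.of A (Fin d → A))
    (LinearEquiv.refl A (Fin d → A))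
  let b : Module.Basis (Fin d) k M.obj := Module.finBasis k M.obj
  let G : FinDimMod k A := ⟨ModuleCat.of A (Fin d → A), hF⟩
  -- The standard generators go to a `k`-basis of `M`, so vectors with entries in `k` already cover
  -- `M`.
  let π : G ⟶ M := ObjectProperty.homMk (ModuleCat.ofHom (Fintype.linearCombination A b))
  refine ⟨G, π, inferInstanceAs (Module.Projective A (Fin d → A)), ⟨fun g h hgh => ?_⟩, ?_⟩
  · ext x
    obtain ⟨y, rfl⟩ : ∃ y, π.hom.hom y = x := by
      refine ⟨fun i => algebraMap k A (b.repr x i), ?_⟩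
      change Fintype.linearCombination A b _ = x
      rw [Fintype.linearCombination_apply]
      simp only [algebraMap_smul]
      exact b.sum_repr x
    exact congrArg (fun g => g.hom.hom y) hgh
  · refine (hFd.trans ?_).le
    rw [Module.finrank_pi_fintype]
    simp [d, mul_comm]

end Dimension

/-! ### Killing cohomology from the top by cones of projective covers -/

section Approximation

open Pretriangulated

variable {k : Type u} [Field k] {A : Type v} [Ring A] [Algebra k A]

/-- The cohomology of an object of the homotopy category. -/
noncomputable abbrev cohomologyK (X : HomotopyCategory (FinDimMod k A) (.up ℤ)) (j : ℤ) :
    FinDimMod k A :=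
  (HomotopyCategory.homologyFunctor (FinDimMod k A) (.up ℤ) j).obj X

lemma dim_cohomologyK_le₃ {T : Triangle (HomotopyCategory (FinDimMod k A) (.up ℤ))}
    (hT : T ∈ distTriang _) (j : ℤ) :
    dim (cohomologyK T.obj₃ j) ≤ dim (cohomologyK T.obj₂ j) + dim (cohomologyK T.obj₁ (j + 1)) :=
  dim_le_of_exact
    ((HomotopyCategory.homologyFunctor (FinDimMod k A) (.up ℤ) 0).homologySequence_exact₃ T hT
      j (j + 1) rfl)

lemma dim_cohomologyK_le₁ {T : Triangle (HomotopyCategory (FinDimMod k A) (.up ℤ))}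
    (hT : T ∈ distTriang _) (j : ℤ) :
    dim (cohomologyK T.obj₁ j) ≤ dim (cohomologyK T.obj₃ (j - 1)) + dim (cohomologyK T.obj₂ j) :=
  dim_le_of_exact
    ((HomotopyCategory.homologyFunctor (FinDimMod k A) (.up ℤ) 0).homologySequence_exact₁ T hT
      (j - 1) j (by lia))

/-- If the first morphism of a triangle is an epimorphism on `H^j` and `H^{j+1}` of the first
object vanishes, then so does `H^j` of the third object. -/
lemma dim_cohomologyK_eq_zero_of_epi {T : Triangle (HomotopyCategory (FinDimMod k A) (.up ℤ))}
    (hT : T ∈ distTriang _) (j : ℤ)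
    (hepi : Epi ((HomotopyCategory.homologyFunctor (FinDimMod k A) (.up ℤ) j).map T.mor₁))
    (h₁ : dim (cohomologyK T.obj₁ (j + 1)) = 0) : dim (cohomologyK T.obj₃ j) = 0 := by
  let F := HomotopyCategory.homologyFunctor (FinDimMod k A) (.up ℤ) 0
  have h := F.homologySequence_exact₃ T hT j (j + 1) rfl
  have hzero := (F.homologySequence_epi_shift_map_mor₁_iff T hT j).1 hepi
  have hmono : Mono (F.homologySequenceδ T j (j + 1) rfl) := h.mono_g hzero
  have h₂ : IsZero ((F.shift (j + 1)).obj T.obj₁) := (isZero_iff_dim_eq_zero _).2 h₁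
  exact (isZero_iff_dim_eq_zero _).1 (@IsZero.of_mono _ _ _ _ _ _ hmono h₂)

/-- A shifted projective module covering a given cohomology module. -/
lemma exists_cover [Module.Finite k A] (L : HomotopyCategory (FinDimMod k A) (.up ℤ)) (n : ℤ) :
    ∃ (G : HomotopyCategory (FinDimMod k A) (.up ℤ)) (f : G ⟶ L), isKbProj k A G ∧
      Epi ((HomotopyCategory.homologyFunctor (FinDimMod k A) (.up ℤ) n).map f) ∧
      (∀ j, j ≠ n → dim (cohomologyK G j) = 0) ∧
      dim (cohomologyK G n) ≤ Module.finrank k A * dim (cohomologyK L n) := by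
  obtain ⟨L, rfl⟩ := L.quotient_obj_surjective
  let α (j : ℤ) := HomotopyCategory.homologyFunctorFactors (FinDimMod k A) (.up ℤ) j
  obtain ⟨G, π, hG, hπ, hdim⟩ := exists_projective_cover (L.homology n)
  have := projective_of_isProj hG
  -- Lifting the cover of `H^n` to cycles turns it into a chain map from the stalk complex of `G` in
  -- degree `n`.
  let l : G ⟶ L.cycles n := Projective.factorThru π (L.homologyπ n)
  let S := (HomologicalComplex.single (FinDimMod k A) (.up ℤ) n).obj G
  let f : S ⟶ L := HomologicalComplex.mkHomFromSingle (l ≫ L.iCycles n) (by simp)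
  have hepi : Epi (HomologicalComplex.homologyMap f n) := by
    let s : G ⟶ S.cycles n := S.liftCycles
      (HomologicalComplex.singleObjXSelf (.up ℤ) n G).inv _ rfl (by simp [S])
    have hs : s ≫ HomologicalComplex.cyclesMap f n = l := by
      rw [← cancel_mono (L.iCycles n)]
      simp [s, f]
    have : (s ≫ S.homologyπ n) ≫ HomologicalComplex.homologyMap f n = π := by
      rw [Category.assoc, HomologicalComplex.homologyπ_naturality, reassoc_of% hs,
        Projective.factorThru_comp]
    exact epi_of_epi_fac this
  have hzero (j : ℤ) (hj : j ≠ n) : IsZero (S.X j) :=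
    HomologicalComplex.isZero_single_obj_X _ _ _ _ hj
  refine ⟨(HomotopyCategory.quotient _ _).obj S, (HomotopyCategory.quotient _ _).map f, ?_, ?_,
    fun j hj => ?_, ?_⟩
  · rw [isKbProj_quotient_obj_iff]
    refine ⟨⟨n, n, fun j hj => hzero j (by simp only [Set.mem_Icc] at hj; lia)⟩, fun j => ?_⟩
    by_cases hj : j = n
    · subst hj
      exact (isProj k A).prop_of_iso (HomologicalComplex.singleObjXSelf (.up ℤ) j G).symm hG
    · exact isProj_of_isZero k A (hzero j hj)
  · have h := (α n).hom.naturality f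
    rw [← IsIso.eq_comp_inv] at h
    refine (h ▸ ?_ : Epi ((HomotopyCategory.quotient _ _ ⋙
      HomotopyCategory.homologyFunctor _ _ n).map f))
    have : Epi ((HomologicalComplex.homologyFunctor _ (.up ℤ) n).map f) := hepi
    infer_instance
  · exact (isZero_iff_dim_eq_zero _).1
      ((ShortComplex.isZero_homology_of_isZero_X₂ _ (hzero j hj)).of_iso ((α j).app S))
  · refine (dim_congr ((α n).app S ≪≫
      HomologicalComplex.singleObjHomologySelfIso (.up ℤ) n G)).le.trans (hdim.trans_eq ?_)
    congr 1
    exact dim_congr ((α n).app L).symm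

/-- An object of the homotopy category is approximated by objects of `K^b(A-proj)`, with control
of the dimensions. -/
lemma exists_trW [Module.Finite k A] {X : HomotopyCategory (FinDimMod k A) (.up ℤ)} {N l : ℕ}
    (hX : ∀ j, j ∉ Set.Icc (-N : ℤ) 0 → dim (cohomologyK X j) = 0)
    (hl : ∀ j, dim (cohomologyK X j) ≤ l) (n : ℕ) (hn : n ≤ N) :
    ∃ (C : HomotopyCategory (FinDimMod k A) (.up ℤ)) (f : X ⟶ C), (isKbProj k A).trW f ∧
      (∀ j, j ∉ Set.Icc (-N : ℤ) (-n) → dim (cohomologyK C j) = 0) ∧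
      ∀ j, dim (cohomologyK C j) ≤ l * (1 + Module.finrank k A) ^ n := by
  induction n with
  | zero => exact ⟨X, 𝟙 X, MorphismProperty.id_mem _ _, by simpa using hX, by simpa using hl⟩
  | succ n ih =>
    obtain ⟨C, f, hf, hC, hCl⟩ := ih (by lia)
    -- The cone of a cover of the top cohomology `H^{-n}(C)` loses that degree. Only `H^{-n-1}` can
    -- grow, by at most `dim G`, whence the factor `1 + dim A` per step.
    obtain ⟨G, g, hG, hg, hG₀, hGd⟩ := exists_cover C (-n : ℤ)
    obtain ⟨C', f', δ, hT⟩ := distinguished_cocone_triangle g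
    refine ⟨C', f ≫ f', MorphismProperty.comp_mem _ _ _ hf
      ((ObjectProperty.trW_iff' _ _).2 ⟨_, _, _, hT, hG⟩), fun j hj => ?_, fun j => ?_⟩
    · have h : dim (cohomologyK C' j) ≤ dim (cohomologyK C j) + dim (cohomologyK G (j + 1)) :=
        dim_cohomologyK_le₃ hT j
      by_cases hjn : j = -n
      · subst hjn
        exact dim_cohomologyK_eq_zero_of_epi hT _ hg (hG₀ _ (by lia))
      · simp only [Set.mem_Icc] at hj hC
        rw [hC j (by lia), hG₀ (j + 1) (by lia)] at h
        simpa using h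
    · have h : dim (cohomologyK C' j) ≤ dim (cohomologyK C j) + dim (cohomologyK G (j + 1)) :=
        dim_cohomologyK_le₃ hT j
      have h₁ : dim (cohomologyK G (j + 1)) ≤
          Module.finrank k A * (l * (1 + Module.finrank k A) ^ n) := by
        by_cases hj : j + 1 = -n
        · rw [hj]
          exact hGd.trans (Nat.mul_le_mul_left _ (hCl _))
        · simp [hG₀ _ hj]
      calc _ ≤ _ := h
        _ ≤ _ := add_le_add (hCl j) h₁
        _ = _ := by ring

end Approximation

/-! ### From `D^b(A-mod)` to `K^b(A-proj)` by truncation -/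

section Truncation

open Pretriangulated DerivedCategory

lemma indecomposable_shift {C : Type*} [Category* C] [Preadditive C] [HasShift C ℤ]
    [∀ n : ℤ, (shiftFunctor C n).Additive] [HasBinaryBiproducts C] {X : C}
    (hX : Indecomposable X) (n : ℤ) : Indecomposable (X⟦n⟧) := by
  have aux (Y : C) (m : ℤ) (h : IsZero (Y⟦m⟧)) : IsZero Y :=
    ((shiftFunctor C (-m)).map_isZero h).of_iso (shiftShiftNeg Y m).symm
  refine ⟨fun h => hX.1 (aux X n h), fun Y Z e => ?_⟩
  have := preservesBinaryBiproducts_of_preservesBiproducts (shiftFunctor C (-n))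
  exact (hX.2 _ _ ((shiftShiftNeg X n).symm ≪≫ (shiftFunctor C (-n)).mapIso e ≪≫
    (shiftFunctor C (-n)).mapBiprod Y Z)).imp (aux Y _) (aux Z _)

variable {k : Type u} [Field k] {A : Type v} [Ring A] [Algebra k A]

lemma HomotopyProj.dim_cohomology_biprod (Y Z : HomotopyProj k A) (j : ℤ) :
    dim ((Y ⊞ Z).cohomology j) = dim (Y.cohomology j) + dim (Z.cohomology j) := by
  let F := (isKbProj k A).ι ⋙ HomotopyCategory.homologyFunctor (FinDimMod k A) (.up ℤ) j
  have := preservesBinaryBiproducts_of_preservesBiproducts F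
  exact (dim_congr (F.mapBiprod Y Z)).trans (dim_biprod _ _)

/-- If an additive functor sends an object of `K^b(A-proj)` to an indecomposable object, then it
sends some indecomposable direct summand to an isomorphic object. -/
lemma HomotopyProj.exists_indecomposable {B : Type*} [Category* B] [Preadditive B]
    [HasBinaryBiproducts B] (Ψ : HomotopyProj k A ⥤ B) [Ψ.Additive] {X : B}
    (hX : Indecomposable X) (P : HomotopyProj k A) (e : Ψ.obj P ≅ X) :
    ∃ P' : HomotopyProj k A, Indecomposable P' ∧ Nonempty (Ψ.obj P' ≅ X) ∧
      ∀ j, dim (P'.cohomology j) ≤ dim (P.cohomology j) := by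
  obtain ⟨a, b, hab⟩ := P.exists_bounds
  induction hN : ∑ j ∈ Finset.Icc a b, dim (P.cohomology j) using Nat.strong_induction_on
    generalizing P with
  | _ N ih =>
    by_cases hP : Indecomposable P
    · exact ⟨P, hP, ⟨e⟩, fun _ => le_rfl⟩
    have hP₀ : ¬ IsZero P := fun h => hX.1 ((Ψ.map_isZero h).of_iso e.symm)
    simp only [Indecomposable, hP₀, not_false_eq_true, true_and, not_forall, not_or] at hP
    obtain ⟨Y, Z, f, hY, hZ⟩ := hP
    have := preservesBinaryBiproducts_of_preservesBiproducts Ψ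
    have key (Y Z : HomotopyProj k A) (hY : ¬ IsZero Y) (hΨ : IsZero (Ψ.obj Y)) (f : P ≅ Y ⊞ Z) :
        ∃ P' : HomotopyProj k A, Indecomposable P' ∧ Nonempty (Ψ.obj P' ≅ X) ∧
          ∀ j, dim (P'.cohomology j) ≤ dim (P.cohomology j) := by
      have hdim (j : ℤ) :
          dim (P.cohomology j) = dim (Y.cohomology j) + dim (Z.cohomology j) := by
        rw [dim_cohomology_congr f, dim_cohomology_biprod]
      have e' : Ψ.obj Z ≅ X :=
        (isoZeroBiprod hΨ) ≪≫ (Ψ.mapBiprod Y Z).symm ≪≫ Ψ.mapIso f.symm ≪≫ e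
      -- The discarded summand `Y` is killed by `Ψ` but nonzero, so it carries cohomology and the
      -- total dimension drops.
      obtain ⟨j₀, hj₀⟩ := exists_cohomology_ne_zero hY
      have hlt : ∑ j ∈ Finset.Icc a b, dim (Z.cohomology j) < N := by
        rw [← hN]
        refine Finset.sum_lt_sum (fun j _ => by rw [hdim]; lia) ⟨j₀, ?_, by rw [hdim]; lia⟩
        have := hdim j₀
        simpa using not_imp_comm.1 (hab j₀) (by lia)
      obtain ⟨P', h₁, h₂, h₃⟩ := ih _ hlt Z e'
        (fun j hj => by have := hab j hj; have := hdim j; lia) rfl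
      exact ⟨P', h₁, h₂, fun j => (h₃ j).trans (by rw [hdim]; lia)⟩
    rcases hX.2 _ _ (e.symm ≪≫ Ψ.mapIso f ≪≫ Ψ.mapBiprod Y Z) with h | h
    · exact key Y Z hY h f
    · exact key Z Y hZ h (f ≪≫ biprod.braiding Y Z)

variable [HasDerivedCategory.{w} (FinDimMod k A)]

/-- The cohomology of an object of `D^b(A-mod)` is not identically zero. -/
lemma exists_cohomology_ne_zero {X : Bounded (FinDimMod k A)} (hX : ¬ IsZero X) :
    ∃ j, dim (cohomology X.obj j) ≠ 0 := by
  by_contra! h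
  have h₁ : X.obj.IsGE 1 := (isGE_iff _ _).2 fun j _ => (isZero_iff_dim_eq_zero _).2 (h j)
  have h₂ : X.obj.IsLE 0 := (isLE_iff _ _).2 fun j _ => (isZero_iff_dim_eq_zero _).2 (h j)
  refine hX ?_
  rw [IsZero.iff_id_eq_zero]
  ext1
  exact TStructure.t.zero_of_isLE_of_isGE _ 0 1 (by lia) h₂ h₁

lemma dim_cohomology_truncGE_le (X : DerivedCategory (FinDimMod k A)) (n j : ℤ) :
    dim (cohomology ((TStructure.t.truncGE n).obj X) j) ≤ dim (cohomology X j) := by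
  by_cases hj : j < n
  · rw [(isZero_iff_dim_eq_zero _).1 (isZero_of_isGE _ n j hj)]
    exact Nat.zero_le _
  · have h := dim_le_of_exact
      ((DerivedCategory.homologyFunctor (FinDimMod k A) 0).homologySequence_exact₃ _
        (TStructure.t.triangleLTGE_distinguished n X) j (j + 1) rfl)
    have h₁ : dim (cohomology ((TStructure.t.truncLT n).obj X) (j + 1)) = 0 := by
      have : ((TStructure.t.truncLT n).obj X).IsLE (n - 1) := inferInstance
      exact (isZero_iff_dim_eq_zero _).1 (isZero_of_isLE _ (n - 1) _ (by lia))
    change dim (cohomology ((TStructure.t.truncGE n).obj X) j) ≤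
      dim (cohomology X j) + dim (cohomology ((TStructure.t.truncLT n).obj X) (j + 1)) at h
    rwa [h₁, add_zero] at h

variable (k A) in
/-- Truncation `τ^{≥ n}` as a functor from `K^b(A-proj)` to `D^b(A-mod)`. -/
noncomputable def truncation (n : ℤ) : HomotopyProj k A ⥤ Bounded (FinDimMod k A) :=
  TStructure.t.bounded.lift ((isKbProj k A).ι ⋙ Qh ⋙ TStructure.t.truncGE n) fun X => by
    obtain ⟨a, b, h⟩ := X.exists_bounds
    refine (bounded_iff _).2 ⟨a, b, fun j hj => Nat.eq_zero_of_le_zero ?_⟩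
    exact (dim_cohomology_truncGE_le _ n j).trans
      ((dim_cohomology_Qh X.obj j).trans (h j hj)).le

instance (n : ℤ) : (truncation k A n).Additive where
  map_add {X Y f g} := by
    ext1
    exact ((isKbProj k A).ι ⋙ Qh ⋙ TStructure.t.truncGE n).map_add

/-- An object of `D^b(A-mod)` with cohomology in degrees `-c, …, 0` is the truncation of an object
of `K^b(A-proj)` with bounded cohomology. -/
lemma exists_truncation_iso [Module.Finite k A] {X : Bounded (FinDimMod k A)} {c l : ℕ}
    (hX : ∀ j, j ∉ Set.Icc (-c : ℤ) 0 → dim (cohomology X.obj j) = 0)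
    (hl : ∀ j, dim (cohomology X.obj j) ≤ l) :
    ∃ P : HomotopyProj k A, Nonempty ((truncation k A (-c)).obj P ≅ X) ∧
      (∀ j, j ∉ Set.Icc (-c - 1 : ℤ) 0 → dim (P.cohomology j) = 0) ∧
      ∀ j, dim (P.cohomology j) ≤ l * (1 + Module.finrank k A) ^ (c + 2) + l := by
  let X' := Qh.objPreimage X.obj
  let e : Qh.obj X' ≅ X.obj := Qh.objObjPreimageIso X.obj
  have hX' (j : ℤ) : dim (cohomologyK X' j) = dim (cohomology X.obj j) := by
    rw [← dim_cohomology_Qh, dim_cohomology_congr e]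
  -- After `c + 2` steps `C` has cohomology only in degree `-c - 2`. Hence `C⟦-1⟧` lives in degree
  -- `-c - 1`, just below the truncation at `-c`, and the fibre `P` of `f` satisfies `τ^{≥ -c} P ≅
  -- τ^{≥ -c} X ≅ X`.
  obtain ⟨C, f, hf, hC, hCl⟩ := exists_trW (X := X') (N := c + 2) (l := l)
    (fun j hj => by rw [hX', hX]; simp only [Set.mem_Icc] at hj ⊢; lia)
    (fun j => by rw [hX']; exact hl j) (c + 2) le_rfl
  obtain ⟨P, g, δ, hT, hP⟩ := (ObjectProperty.trW_iff' _ _).1 hf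
  have hdim (j : ℤ) : dim (cohomologyK P j) ≤
      dim (cohomologyK C (j - 1)) + dim (cohomologyK X' j) := dim_cohomologyK_le₁ hT j
  refine ⟨⟨P, hP⟩, ⟨TStructure.t.bounded.isoMk ?_⟩, fun j hj => ?_, fun j => ?_⟩
  · have hT' := inv_rot_of_distTriang _ (Qh.map_distinguished _ hT)
    have hLE : (Qh.obj C).IsLE (-c - 2) := (isLE_iff _ _).2 fun j hj => by
      rw [isZero_iff_dim_eq_zero, dim_cohomology_Qh]
      exact hC j (by simp only [Set.mem_Icc]; push_cast; lia)
    have hLE' : ((Qh.obj C)⟦(-1 : ℤ)⟧).IsLE (-c - 1) :=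
      TStructure.t.isLE_shift (Qh.obj C) (-c - 2) (-1) (-c - 1) (by lia)
    have hGE : X.obj.IsGE (-c) := (isGE_iff _ _).2 fun j hj => by
      rw [isZero_iff_dim_eq_zero]
      exact hX j (by simp only [Set.mem_Icc]; lia)
    have hiso : IsIso ((TStructure.t.truncGE (-c)).map (Qh.map g)) :=
      TStructure.t.isIso₂_truncGE_map_of_isLE _ hT' (-c - 1) (-c) (by lia) hLE'
    exact @asIso _ _ _ _ _ hiso ≪≫
      (TStructure.t.truncGE (-c)).mapIso e ≪≫
      (asIso ((TStructure.t.truncGEπ (-c)).app X.obj)).symm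
  · have h := hdim j
    simp only [Set.mem_Icc] at hj hX hC
    rw [hC (j - 1) (by push_cast; lia), hX', hX j (by lia)] at h
    exact Nat.eq_zero_of_le_zero h
  · refine (hdim j).trans (add_le_add (hCl _) ?_)
    rw [hX']
    exact hl j

/-- Up to shift, an indecomposable object of `D^b(A-mod)` of cohomological range `r` is the
truncation of an indecomposable object of `K^b(A-proj)` whose cohomological range is at least `r`
and bounded in terms of `r`. -/
lemma exists_indecomposable_truncation [Module.Finite k A] {X : Bounded (FinDimMod k A)}
    (hX : Indecomposable X) {r : ℕ} (hr : cohomologicalRange (cohomology X.obj) = r) :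
    ∃ (P : HomotopyProj k A) (n : ℤ), Indecomposable P ∧
      Nonempty ((truncation k A (-r)).obj P ≅ X⟦n⟧) ∧
      r ≤ cohomologicalRange P.cohomology ∧
      cohomologicalRange P.cohomology ≤
        (r * (1 + Module.finrank k A) ^ (r + 2) + r) * (r + 2) ∧
      dim (P.cohomology 0) ≠ 0 ∧ ∀ j, 0 < j → dim (P.cohomology j) = 0 := by
  obtain ⟨a, b, hab⟩ := (bounded_iff _).1 X.property
  -- Shifting by the top degree `n` of the cohomology normalizes the top to `0`. The range bounds
  -- both the width and the dimensions, so the support lies in `-r, …, 0`.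
  obtain ⟨n, hn, hmax⟩ := Int.exists_greatest_of_bdd
    (P := fun j => dim (cohomology X.obj j) ≠ 0)
    ⟨b, fun j hj => (Set.mem_Icc.1 (not_imp_comm.1 (hab j) hj)).2⟩
    (exists_cohomology_ne_zero hX.1)
  have hdim (j : ℤ) : dim (cohomology (X⟦n⟧).obj j) = dim (cohomology X.obj (j + n)) :=
    (dim_cohomology_congr ((TStructure.t.bounded.ι.commShiftIso n).app X) j).trans
      (dim_cohomology_shift X.obj n j)
  have hsupp : ∀ j, j ∉ Set.Icc (-r : ℤ) 0 → dim (cohomology (X⟦n⟧).obj j) = 0 := by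
    intro j hj
    by_contra h
    rw [hdim] at h
    have h₁ := hmax _ h
    have h₂ := sub_add_one_le_cohomologicalRange hab h hn
    change _ ≤ ((cohomologicalRange (cohomology X.obj) : ℕ) : ℤ) at h₂
    simp only [Set.mem_Icc] at hj
    lia
  have hl (j : ℤ) : dim (cohomology (X⟦n⟧).obj j) ≤ r := by
    rw [hdim, ← hr]
    exact dim_le_cohomologicalRange hab _
  obtain ⟨P, ⟨e⟩, hP, hPl⟩ := exists_truncation_iso hsupp hl
  obtain ⟨P', hP', ⟨e'⟩, hle⟩ := HomotopyProj.exists_indecomposable _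
    (indecomposable_shift hX n) P e
  have hP₀ : ∀ j, j ∉ Set.Icc (-r - 1 : ℤ) 0 → dim (P'.cohomology j) = 0 := fun j hj =>
    Nat.eq_zero_of_le_zero ((hle j).trans (hP j hj).le)
  -- Truncation only removes cohomology, and `X⟦n⟧` is a truncation of `P'`. This gives the lower
  -- bound `r` on the range and keeps `H^0(P')` nonzero.
  have hge (j : ℤ) : dim (cohomology (X⟦n⟧).obj j) ≤ dim (P'.cohomology j) := by
    refine (dim_cohomology_congr (TStructure.t.bounded.ι.mapIso e') j).symm.le.trans ?_
    exact (dim_cohomology_truncGE_le _ _ j).trans (dim_cohomology_Qh P'.obj j).le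
  refine ⟨P', n, hP', ⟨e'⟩, ?_, ?_, ?_, fun j hj => hP₀ j (by simp only [Set.mem_Icc]; lia)⟩
  · rw [← hr, ← cohomologicalRange_shift n hdim]
    exact cohomologicalRange_mono hP₀ hge
  · refine (cohomologicalRange_le hP₀ fun j => (hle j).trans (hPl j)).trans_eq ?_
    congr 1
    lia
  · have h₁ := hge 0
    rw [hdim, zero_add] at h₁
    lia

variable (k A) in
/-- If `A` is strongly derived unbounded, then `K^b(A-proj)` is of strongly unbounded type. -/
theorem HomotopyProj.stronglyUnbounded_of_derived [Module.Finite k A]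
    (h : StronglyDerivedUnbounded.{w} k A) : HomotopyProj.StronglyUnbounded k A := by
  obtain ⟨r, hr, h⟩ := h
  let S (s : ℕ) : Set (Quotient (shiftSetoid (HomotopyProj k A))) :=
    Quotient.mk _ '' {X | Indecomposable X ∧ cohomologicalRange X.cohomology = s}
  -- Since `i ≤ r i`, the ranges `s` attained infinitely often are unbounded and can be enumerated
  -- increasingly.
  suffices hS : ∀ i, ∃ s, r i ≤ s ∧ (S s).Infinite by
    obtain ⟨φ, hφ, hφ'⟩ := Filter.extraction_of_frequently_atTop (P := fun s => (S s).Infinite)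
      (Filter.frequently_atTop.2 fun i =>
        let ⟨s, hs, hs'⟩ := hS i
        ⟨s, (hr.le_apply).trans hs, hs'⟩)
    exact ⟨φ, hφ, hφ'⟩
  intro i
  by_contra! hfin
  set R := (r i * (1 + Module.finrank k A) ^ (r i + 2) + r i) * (r i + 2)
  have hU : (⋃ s ∈ Set.Icc (r i) R, S s).Finite :=
    (Set.finite_Icc _ _).biUnion fun s hs => hfin s hs.1
  have key : ∀ x ∈ Quotient.mk (shiftSetoid (Bounded (FinDimMod k A))) ''
      {X | Indecomposable X ∧ cohomologicalRange (DerivedRepType.cohomology X.obj) = r i},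
      ∃ (P : HomotopyProj k A), Quotient.mk _ P ∈ ⋃ s ∈ Set.Icc (r i) R, S s ∧
        x = Quotient.mk _ ((truncation k A (-r i)).obj P) ∧
        dim (P.cohomology 0) ≠ 0 ∧ ∀ j, 0 < j → dim (P.cohomology j) = 0 := by
    rintro _ ⟨X, ⟨hX, hXr⟩, rfl⟩
    obtain ⟨P, n, hP, ⟨e⟩, h₁, h₂, h₃, h₄⟩ := exists_indecomposable_truncation hX hXr
    refine ⟨P, ?_, Eq.symm (Quotient.sound ?_), h₃, h₄⟩
    · exact Set.mem_biUnion (x := cohomologicalRange P.cohomology) ⟨h₁, h₂⟩ ⟨P, ⟨hP, rfl⟩, rfl⟩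
    · exact ⟨n, ⟨e⟩⟩
  choose! P hPS hPx hP₀ hP₁ using key
  refine h i (Set.Finite.of_injOn (f := fun x => Quotient.mk _ (P x)) hPS ?_ hU)
  intro x hx y hy hxy
  obtain ⟨n, ⟨e⟩⟩ := Quotient.exact hxy
  have hdim (j : ℤ) : dim ((P x).cohomology j) = dim ((P y).cohomology (j + n)) := by
    rw [HomotopyProj.dim_cohomology_congr e, HomotopyProj.dim_cohomology_shift]
  -- Truncation does not commute with shifts, so `P x` and `P y` must be isomorphic without shift.
  -- Both have top cohomology in degree `0`, which forces this.
  obtain rfl : n = 0 := by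
    have h₁ : ¬ 0 < n := fun hn => hP₀ x hx (by rw [hdim, hP₁ y hy _ (by lia)])
    have h₂ : ¬ 0 < -n := fun hn => hP₀ y hy (by
      have := hdim (-n)
      rwa [hP₁ x hx _ hn, neg_add_cancel, eq_comm] at this)
    lia
  rw [hPx x hx, hPx y hy]
  refine Quotient.sound ⟨0, ⟨(truncation k A _).mapIso (e ≪≫ (shiftFunctorZero _ ℤ).app _) ≪≫
    ((shiftFunctorZero _ ℤ).app _).symm⟩⟩

end Truncation

end DerivedRepType

theorem mainTheorem6 (k : Type u) [Field k] [Infinite k]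
    (A : Type v) [Ring A] [Algebra k A] [Module.Finite k A]
    [HasDerivedCategory.{w} (DerivedRepType.FinDimMod k A)] :
    ((∃ m : ℕ, 1 ≤ m ∧ DerivedRepType.MinimalComplexes.StronglyUnbounded k A m) →
      DerivedRepType.HomotopyProj.StronglyUnbounded k A) ∧
    (DerivedRepType.HomotopyProj.StronglyUnbounded k A ↔
      DerivedRepType.StronglyDerivedUnbounded.{w} k A) :=
  ⟨fun ⟨_, _, h⟩ => DerivedRepType.HomotopyProj.stronglyUnbounded_of_minimalComplexes k A h,
    DerivedRepType.stronglyDerivedUnbounded_of_homotopyProj k A,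
    DerivedRepType.HomotopyProj.stronglyUnbounded_of_derived k A⟩
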